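/- A positive continuous function $\omega$ on $[0,1)$ is called \emph{normal} if there are constants $\delta\in[0,1)$ and $0<a<b<\infty$ such that on $[\delta,1)$ the function $\omega(r)/(1-r)^a$ is decreasing and $\omega(r)/(1-r)^b$ is increasing (both in the weak sense). Let $\mathbb{B}$ be the open unit ball of a complex Banach space $X$ and let $H(\mathbb{B})$ be the set of holomorphic functions $f:\mathbb{B}\to\mathbb{C}$. For $f\in H(\mathbb{B})$ let $\mathcal{R}f(z)=Df(z)z$, where $Df$ is the Fréchet derivative. For a normal function $\omega$, let $\mathcal{B}_{\mathcal{R}}(\mathbb{B})_{\omega,0}$ be the space of all $f\in H(\mathbb{B})$ with $\lim_{\|z\|\to1}\omega(\|z\|)\,|\mathcal{R}f(z)|=0$, with the norm $\|f\|_{\mathcal{R},\omega}=|f(0)|+\sup_{z\in\mathbb{B}}\omega(\|z\|)\,|\mathcal{R}f(z)|$. Let $\omega$ and $\mu$ be normal functions and let $\varphi\in H(\mathbb{B})$. For $f\in H(\mathbb{B})$ and $z\in\mathbb{B}$ let $$T_\varphi f(z)=\int_0^1 f(tz)\,\mathcal{R}\varphi(tz)\,\frac{dt}{t}.$$ Assume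 that for all $\varepsilon>0$ and $\rho\in(0,1)$ the set $$E_{\varepsilon,\rho}=\{z\in\mathbb{B}:\ \|z\|\le\rho,\ \text{there is } s\in[1,\rho^{-1}] \text{ with } sz\in\mathbb{B} \text{ and } \mu(\|sz\|)\,|\mathcal{R}\varphi(sz)|\ge\varepsilon\}$$ is relatively compact in $\mathbb{B}$, and that $\int_0^1\frac{1}{\omega(t)}\,dt<\infty$. Then $T_\varphi$ is a compact operator from $\mathcal{B}_{\mathcal{R}}(\mathbb{B})_{\omega,0}$ to $\mathcal{B}_{\mathcal{R}}(\mathbb{B})_{\mu,0}$ if and only if $\varphi\in\mathcal{B}_{\mathcal{R}}(\mathbb{B})_{\mu,0}$. -/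

import Mathlib

open Set Metric Filter Topology MeasureTheory

noncomputable section

/-- A normal function on `[0,1)`: positive, continuous, and for some `δ ∈ [0,1)` and `0 < a < b`
the quotient `ω(r)/(1-r)^a` is decreasing and `ω(r)/(1-r)^b` is increasing on `[δ,1)`.
Only the values on `[0,1)` matter. -/
structure NormalFunction where
  toFun : ℝ → ℝ
  pos : ∀ r ∈ Ico (0 : ℝ) 1, 0 < toFun r
  continuousOn : ContinuousOn toFun (Ico 0 1)
  normal : ∃ δ ∈ Ico (0 : ℝ) 1, ∃ a b : ℝ, 0 < a ∧ a < b ∧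
    AntitoneOn (fun r => toFun r / (1 - r) ^ a) (Ico δ 1) ∧
    MonotoneOn (fun r => toFun r / (1 - r) ^ b) (Ico δ 1)

instance : CoeFun NormalFunction (fun _ => ℝ → ℝ) := ⟨NormalFunction.toFun⟩

section Predicates

variable {X : Type*} [NormedAddCommGroup X] [NormedSpace ℂ X]

/-- The radial derivative `Rf(z) = Df(z)z`. -/
def radialDeriv (f : X → ℂ) (z : X) : ℂ := fderiv ℂ f z z

/-- Bloch-type functions on the open unit ball. A function on the ball is given by
any function on `X`; its values outside the ball play no role here. -/
def MemBloch (ω : NormalFunction) (f : X → ℂ) : Prop :=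
  DifferentiableOn ℂ f (ball 0 1) ∧
    BddAbove (range fun z : ball (0 : X) 1 => ω ‖(z : X)‖ * ‖radialDeriv f z‖)

/-- Little Bloch-type functions: `ω(‖z‖)|Rf(z)| → 0` as `‖z‖ → 1` within the ball. -/
def MemLittleBloch (ω : NormalFunction) (f : X → ℂ) : Prop :=
  DifferentiableOn ℂ f (ball 0 1) ∧
    Tendsto (fun z : X => ω ‖z‖ * ‖radialDeriv f z‖) (comap norm (𝓝[<] (1 : ℝ))) (𝓝 0)

/-- The extended Cesàro operator `T_φ f(z) = ∫₀¹ f(tz) Rφ(tz) t⁻¹ dt`. -/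
def cesaro (φ f : X → ℂ) (z : X) : ℂ :=
  ∫ t in (0 : ℝ)..1, f ((t : ℂ) • z) * radialDeriv φ ((t : ℂ) • z) * (1 / (t : ℂ))

/-- The set `E_{ε,ρ}` of the symbol `φ`. The point `s z` has to lie in the unit ball, where
`μ` and `φ` are defined. -/
def symbolSet (μ : NormalFunction) (φ : X → ℂ) (ε ρ : ℝ) : Set X :=
  {z | ‖z‖ < 1 ∧ ‖z‖ ≤ ρ ∧ ∃ s ∈ Icc (1 : ℝ) ρ⁻¹, ‖(s : ℂ) • z‖ < 1 ∧
    ε ≤ μ ‖(s : ℂ) • z‖ * ‖radialDeriv φ ((s : ℂ) • z)‖}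

/-- A subset of the open unit ball is relatively compact in it. -/
def RelativelyCompactInBall (E : Set X) : Prop :=
  ∃ K : Set X, IsCompact K ∧ K ⊆ ball 0 1 ∧ E ⊆ K

lemma differentiableAt_of_ball {f : X → ℂ} (hf : DifferentiableOn ℂ f (ball 0 1)) {z : X}
    (hz : z ∈ ball (0 : X) 1) : DifferentiableAt ℂ f z :=
  hf.differentiableAt (isOpen_ball.mem_nhds hz)

lemma radialDeriv_add {f g : X → ℂ} (hf : DifferentiableOn ℂ f (ball 0 1))
    (hg : DifferentiableOn ℂ g (ball 0 1)) {z : X} (hz : z ∈ ball (0 : X) 1) :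
    radialDeriv (f + g) z = radialDeriv f z + radialDeriv g z := by
  simp [radialDeriv, fderiv_add (differentiableAt_of_ball hf hz) (differentiableAt_of_ball hg hz)]

lemma radialDeriv_smul {f : X → ℂ} (hf : DifferentiableOn ℂ f (ball 0 1)) (c : ℂ)
    {z : X} (hz : z ∈ ball (0 : X) 1) :
    radialDeriv (c • f) z = c * radialDeriv f z := by
  simp [radialDeriv, fderiv_const_smul (differentiableAt_of_ball hf hz) c]

lemma normalFunction_pos {X : Type*} [NormedAddCommGroup X] (ω : NormalFunction) {z : X}
    (hz : z ∈ ball (0 : X) 1) :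
    0 < ω ‖z‖ :=
  ω.pos _ ⟨norm_nonneg z, by simpa using hz⟩

lemma eventually_mem_ball {X : Type*} [NormedAddCommGroup X] :
    ∀ᶠ z : X in comap norm (𝓝[<] (1 : ℝ)), z ∈ ball (0 : X) 1 := by
  filter_upwards [preimage_mem_comap (self_mem_nhdsWithin (a := (1 : ℝ)) (s := Iio 1))] with z hz
  simpa using hz

/-- On a complex line through the origin, `Rf` is `ζ ↦ ζ h'(ζ)` with `h` the slice of `f`. -/
lemma hasDerivAt_slice {f : X → ℂ} (hf : DifferentiableOn ℂ f (ball 0 1)) (u : X) {ζ : ℂ}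
    (h : ζ • u ∈ ball (0 : X) 1) :
    HasDerivAt (fun ζ : ℂ => f (ζ • u)) (fderiv ℂ f (ζ • u) u) ζ := by
  have h1 : HasDerivAt (fun ζ : ℂ => ζ • u) u ζ := by
    simpa using (hasDerivAt_id ζ).smul_const u
  exact (differentiableAt_of_ball hf h).hasFDerivAt.comp_hasDerivAt ζ h1

lemma differentiableOn_radialDeriv_slice {f : X → ℂ} (hf : DifferentiableOn ℂ f (ball 0 1))
    (u : X) :
    DifferentiableOn ℂ (fun ζ : ℂ => radialDeriv f (ζ • u)) {ζ : ℂ | ζ • u ∈ ball (0 : X) 1} := by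
  have ho : IsOpen {ζ : ℂ | ζ • u ∈ ball (0 : X) 1} :=
    isOpen_ball.preimage (continuous_id.smul continuous_const)
  have h1 : DifferentiableOn ℂ (fun ζ : ℂ => f (ζ • u)) {ζ : ℂ | ζ • u ∈ ball (0 : X) 1} :=
    fun ζ hζ => (hasDerivAt_slice hf u hζ).differentiableAt.differentiableWithinAt
  refine (differentiableOn_id.mul (h1.deriv ho)).congr fun ζ hζ => ?_
  simp [radialDeriv, (hasDerivAt_slice hf u hζ).deriv]

/-- A holomorphic function whose radial derivative vanishes is constant. -/
lemma eq_of_radialDeriv_eq_zero {f : X → ℂ} (hf : DifferentiableOn ℂ f (ball 0 1))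
    (h0 : ∀ z ∈ ball (0 : X) 1, radialDeriv f z = 0) {z : X} (hz : z ∈ ball (0 : X) 1) :
    f z = f 0 := by
  have hmem : ∀ ζ ∈ closedBall (0 : ℂ) 1, ζ • z ∈ ball (0 : X) 1 := by
    intro ζ hζ
    simp only [mem_closedBall, mem_ball, dist_zero_right, norm_smul] at *
    nlinarith [norm_nonneg z]
  have hne : ∀ ζ ∈ closedBall (0 : ℂ) 1, ζ ≠ 0 → fderiv ℂ f (ζ • z) z = 0 := by
    intro ζ hζ hz0
    have := h0 _ (hmem ζ hζ)
    rw [radialDeriv, map_smul, smul_eq_mul] at this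
    exact (mul_eq_zero.1 this).resolve_left hz0
  -- the slice is constant on `[t,1]` for every `t > 0`; let `t → 0`
  have hc : ∀ t ∈ Ioo (0 : ℝ) 1, f (((t : ℝ) : ℂ) • z) = f z := by
    intro t ht
    have hd : ∀ x ∈ Icc t 1, HasDerivAt (fun x : ℝ => f ((x : ℂ) • z)) 0 x := by
      intro x hx
      have hx1 : (x : ℂ) ∈ closedBall (0 : ℂ) 1 := by
        simp [abs_of_pos (ht.1.trans_le hx.1), hx.2]
      have hx0 : (x : ℂ) ≠ 0 := by exact_mod_cast (ht.1.trans_le hx.1).ne'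
      have := (hasDerivAt_slice hf z (hmem _ hx1)).comp_ofReal
      rwa [hne _ hx1 hx0] at this
    have := constant_of_has_deriv_right_zero (fun x hx => (hd x hx).continuousAt.continuousWithinAt)
      (fun x hx => (hd x ⟨hx.1, hx.2.le⟩).hasDerivWithinAt) 1 ⟨ht.2.le, le_rfl⟩
    simpa using this.symm
  have hcont : ContinuousAt (fun x : ℝ => f ((x : ℂ) • z)) 0 := by
    have h : ((0 : ℝ) : ℂ) • z ∈ ball (0 : X) 1 := hmem _ (by simp)
    exact (hasDerivAt_slice hf z h).comp_ofReal.continuousAt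
  have ht : Tendsto (fun x : ℝ => f ((x : ℂ) • z)) (𝓝[>] 0) (𝓝 (f 0)) := by
    simpa using hcont.tendsto.mono_left nhdsWithin_le_nhds
  refine tendsto_nhds_unique (tendsto_const_nhds.congr' ?_) ht
  filter_upwards [Ioo_mem_nhdsGT (zero_lt_one' ℝ)] with t h
  exact (hc t h).symm

lemma MemBloch.add {ω : NormalFunction} {f g : X → ℂ} (hf : MemBloch ω f) (hg : MemBloch ω g) :
    MemBloch ω (f + g) := by
  refine ⟨hf.1.add hg.1, ?_⟩
  obtain ⟨A, hA⟩ := hf.2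
  obtain ⟨B, hB⟩ := hg.2
  refine ⟨A + B, ?_⟩
  rintro _ ⟨z, rfl⟩
  have h1 := hA ⟨z, rfl⟩
  have h2 := hB ⟨z, rfl⟩
  have h3 := norm_add_le (radialDeriv f z) (radialDeriv g z)
  simp only [radialDeriv_add hf.1 hg.1 z.2] at *
  nlinarith [normalFunction_pos ω z.2]

lemma MemBloch.smul {ω : NormalFunction} {f : X → ℂ} (c : ℂ) (hf : MemBloch ω f) :
    MemBloch ω (c • f) := by
  refine ⟨hf.1.const_smul c, ?_⟩
  obtain ⟨A, hA⟩ := hf.2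
  refine ⟨‖c‖ * A, ?_⟩
  rintro _ ⟨z, rfl⟩
  have h1 := hA ⟨z, rfl⟩
  simp only [radialDeriv_smul hf.1 c z.2, norm_mul] at *
  nlinarith [norm_nonneg c]

lemma memBloch_zero (ω : NormalFunction) : MemBloch ω (0 : X → ℂ) := by
  refine ⟨differentiableOn_const 0, 0, ?_⟩
  rintro _ ⟨z, rfl⟩
  simp [radialDeriv]

/-- Little Bloch-type functions are Bloch-type functions (maximum principle). -/
lemma MemLittleBloch.memBloch {ω : NormalFunction} {f : X → ℂ} (hf : MemLittleBloch ω f) :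
    MemBloch ω f := by
  refine ⟨hf.1, ?_⟩
  have h1 := hf.2.eventually (gt_mem_nhds (zero_lt_one' ℝ))
  obtain ⟨s, hs, hs'⟩ := mem_comap.1 h1
  obtain ⟨l, hl, hls⟩ := (mem_nhdsLT_iff_exists_Ioo_subset' (zero_lt_one' ℝ)).1 hs
  obtain ⟨R, hR0, hR1⟩ := exists_between (max_lt hl (zero_lt_one' ℝ))
  have hRpos : 0 < R := (le_max_right _ _).trans_lt hR0
  have hlR : l < R := (le_max_left _ _).trans_lt hR0
  have hout : ∀ z : X, R ≤ ‖z‖ → ‖z‖ < 1 → ω ‖z‖ * ‖radialDeriv f z‖ < 1 := fun z h h' =>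
    hs' (hls ⟨hlR.trans_le h, h'⟩)
  obtain ⟨M, hM⟩ := isCompact_Icc.bddAbove_image
    (ω.continuousOn.mono (Icc_subset_Ico_right hR1 : Icc 0 R ⊆ Ico 0 1))
  have hωR := ω.pos R ⟨hRpos.le, hR1⟩
  refine ⟨max 1 (M * (1 / ω R)), ?_⟩
  rintro _ ⟨⟨z, hz⟩, rfl⟩
  have hz1 : ‖z‖ < 1 := by simpa using hz
  rcases le_or_gt R ‖z‖ with h | h
  · exact (hout z h hz1).le.trans (le_max_left _ _)
  refine le_trans ?_ (le_max_right _ _)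
  have hbound : ‖radialDeriv f z‖ ≤ 1 / ω R := by
    rcases eq_or_ne z 0 with rfl | hz0
    · simp [radialDeriv, hωR.le]
    have hzp : 0 < ‖z‖ := norm_pos_iff.2 hz0
    have hn : ∀ ζ : ℂ, ‖ζ • z‖ = ‖ζ‖ * ‖z‖ := fun ζ => norm_smul _ _
    have hsub : closedBall (0 : ℂ) (R / ‖z‖) ⊆ {ζ : ℂ | ζ • z ∈ ball (0 : X) 1} := by
      intro ζ hζ
      have : ‖ζ‖ * ‖z‖ ≤ R := (le_div_iff₀ hzp).1 (by simpa using hζ)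
      simp only [mem_ofPred_eq, mem_ball, dist_zero_right, hn]
      linarith
    have hd : DiffContOnCl ℂ (fun ζ : ℂ => radialDeriv f (ζ • z)) (ball 0 (R / ‖z‖)) :=
      ((differentiableOn_radialDeriv_slice hf.1 z).mono
        (closure_ball_subset_closedBall.trans hsub)).diffContOnCl
    have := Complex.norm_le_of_forall_mem_frontier_norm_le (C := 1 / ω R) isBounded_ball hd ?_
      (z := 1) (subset_closure (by simpa [lt_div_iff₀ hzp] using h))
    · simpa using this
    · intro ζ hζ
      rw [frontier_ball _ (by positivity)] at hζ
      have hζn : ‖ζ • z‖ = R := by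
        rw [hn, mem_sphere_zero_iff_norm.1 hζ, div_mul_cancel₀ _ hzp.ne']
      have := hout (ζ • z) hζn.ge (hζn ▸ hR1)
      rw [hζn] at this
      rw [le_div_iff₀ hωR]
      linarith
  exact mul_le_mul (hM ⟨‖z‖, ⟨norm_nonneg z, h.le⟩, rfl⟩) hbound (norm_nonneg _)
    ((normalFunction_pos ω hz).le.trans (hM ⟨‖z‖, ⟨norm_nonneg z, h.le⟩, rfl⟩))

end Predicates

section Spaces

variable (X : Type*) [NormedAddCommGroup X] [NormedSpace ℂ X]

/-- The vector space of Bloch-type functions. A function on the unit ball is represented by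
its extension by `0` to `X`, so that equality is equality on the ball. -/
def blochSubmodule (ω : NormalFunction) : Submodule ℂ (X → ℂ) where
  carrier := {f | MemBloch ω f ∧ ∀ z ∉ ball (0 : X) 1, f z = 0}
  zero_mem' := ⟨memBloch_zero ω, fun _ _ => rfl⟩
  add_mem' hf hg := ⟨hf.1.add hg.1, fun z hz => by simp [hf.2 z hz, hg.2 z hz]⟩
  smul_mem' c _ hf := ⟨hf.1.smul c, fun z hz => by simp [hf.2 z hz]⟩

/-- The Bloch-type space. (A type of its own, so that its topology is the
one of the norm below and not that of pointwise convergence.) -/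
def BlochSpace (ω : NormalFunction) : Type _ := blochSubmodule X ω

variable {X} {ω : NormalFunction}

instance : AddCommGroup (BlochSpace X ω) := inferInstanceAs (AddCommGroup (blochSubmodule X ω))

instance : Module ℂ (BlochSpace X ω) := inferInstanceAs (Module ℂ (blochSubmodule X ω))

instance : CoeFun (BlochSpace X ω) (fun _ => X → ℂ) := ⟨fun f => f.1⟩

/-- The norm `|f(0)| + sup_{z ∈ B} ω(‖z‖)|Rf(z)|`. -/
instance : Norm (BlochSpace X ω) :=
  ⟨fun f => ‖f 0‖ + ⨆ z : ball (0 : X) 1, ω ‖(z : X)‖ * ‖radialDeriv f z‖⟩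

lemma blochSpace_norm_def (f : BlochSpace X ω) :
    ‖f‖ = ‖f 0‖ + ⨆ z : ball (0 : X) 1, ω ‖(z : X)‖ * ‖radialDeriv f z‖ := rfl

lemma blochSpace_core : NormedSpace.Core ℂ (BlochSpace X ω) where
  norm_nonneg f := add_nonneg (norm_nonneg _) (Real.iSup_nonneg fun z =>
    mul_nonneg (normalFunction_pos ω z.2).le (norm_nonneg _))
  norm_smul c f := by
    simp only [blochSpace_norm_def, mul_add, Real.mul_iSup_of_nonneg (norm_nonneg c)]
    congr 1
    · exact norm_mul c (f 0)
    · refine iSup_congr fun z => ?_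
      have : radialDeriv (c • f : BlochSpace X ω) z = c * radialDeriv f z :=
        radialDeriv_smul f.2.1.1 c z.2
      rw [this, norm_mul]
      ring
  norm_triangle f g := by
    have : Nonempty (ball (0 : X) 1) := ⟨⟨0, by simp⟩⟩
    simp only [blochSpace_norm_def]
    have h0 : ‖(f + g : BlochSpace X ω) 0‖ ≤ ‖f 0‖ + ‖g 0‖ := norm_add_le (f 0) (g 0)
    have h1 : (⨆ z : ball (0 : X) 1, ω ‖(z : X)‖ * ‖radialDeriv (f + g : BlochSpace X ω) z‖) ≤
        (⨆ z : ball (0 : X) 1, ω ‖(z : X)‖ * ‖radialDeriv f z‖) +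
          ⨆ z : ball (0 : X) 1, ω ‖(z : X)‖ * ‖radialDeriv g z‖ := by
      refine ciSup_le fun z => ?_
      have e : radialDeriv (f + g : BlochSpace X ω) z = radialDeriv f z + radialDeriv g z :=
        radialDeriv_add f.2.1.1 g.2.1.1 z.2
      rw [e]
      have h2 := le_ciSup f.2.1.2 z
      have h3 := le_ciSup g.2.1.2 z
      have h4 := norm_add_le (radialDeriv f z) (radialDeriv g z)
      have h5 := mul_le_mul_of_nonneg_left h4 (normalFunction_pos ω z.2).le
      linarith
    linarith
  norm_eq_zero_iff f := by
    have : Nonempty (ball (0 : X) 1) := ⟨⟨0, by simp⟩⟩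
    constructor
    · intro h
      have hs : 0 ≤ ⨆ z : ball (0 : X) 1, ω ‖(z : X)‖ * ‖radialDeriv f z‖ :=
        Real.iSup_nonneg fun z => mul_nonneg (normalFunction_pos ω z.2).le (norm_nonneg _)
      rw [blochSpace_norm_def] at h
      have h0 : f 0 = 0 := norm_eq_zero.1 (by linarith [norm_nonneg (f 0)])
      have hR : ∀ z ∈ ball (0 : X) 1, radialDeriv f z = 0 := by
        intro z hz
        have h2 := le_ciSup f.2.1.2 ⟨z, hz⟩
        have h3 := normalFunction_pos ω hz
        have h4 : ω ‖z‖ * ‖radialDeriv f z‖ ≤ 0 := by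
          refine h2.trans ?_
          linarith [norm_nonneg (f 0)]
        exact norm_le_zero_iff.1 (nonpos_of_mul_nonpos_right h4 h3)
      refine Subtype.ext (funext fun z => ?_)
      by_cases hz : z ∈ ball (0 : X) 1
      · exact (eq_of_radialDeriv_eq_zero f.2.1.1 hR hz).trans h0
      · exact f.2.2 z hz
    · rintro rfl
      have : ∀ z : X, radialDeriv (0 : BlochSpace X ω) z = 0 := fun z => by
        change fderiv ℂ (0 : X → ℂ) z z = 0
        simp
      have e : (0 : BlochSpace X ω) (0 : X) = 0 := rfl
      simp [blochSpace_norm_def, this, e]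

instance : NormedAddCommGroup (BlochSpace X ω) := NormedAddCommGroup.ofCore blochSpace_core

instance : NormedSpace ℂ (BlochSpace X ω) := NormedSpace.ofCore blochSpace_core

variable (X ω)

/-- The little Bloch-type space, a subspace of the Bloch-type space with the induced norm. -/
def littleBlochSpace : Submodule ℂ (BlochSpace X ω) where
  carrier := {f | MemLittleBloch ω f}
  zero_mem' := by
    refine ⟨(memBloch_zero ω).1, ?_⟩
    change Tendsto (fun z : X => ω ‖z‖ * ‖fderiv ℂ (0 : X → ℂ) z z‖) _ _
    simpa using tendsto_const_nhds
  add_mem' {f g} hf hg := by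
    refine ⟨hf.1.add hg.1, ?_⟩
    refine squeeze_zero' ?_ ?_ (by simpa using hf.2.add hg.2)
    · filter_upwards [eventually_mem_ball] with z hz
      exact mul_nonneg (normalFunction_pos ω hz).le (norm_nonneg _)
    · filter_upwards [eventually_mem_ball] with z hz
      have e : radialDeriv (f + g : BlochSpace X ω) z = radialDeriv f z + radialDeriv g z :=
        radialDeriv_add hf.1 hg.1 hz
      rw [e, ← mul_add]
      exact mul_le_mul_of_nonneg_left (norm_add_le _ _) (normalFunction_pos ω hz).le
  smul_mem' c f hf := by
    refine ⟨hf.1.const_smul c, ?_⟩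
    have h := hf.2.const_mul ‖c‖
    rw [mul_zero] at h
    refine h.congr' ?_
    filter_upwards [eventually_mem_ball] with z hz
    have e : radialDeriv (c • f : BlochSpace X ω) z = c * radialDeriv f z :=
      radialDeriv_smul hf.1 c hz
    rw [e, norm_mul]
    ring

end Spaces

/-- `T_φ` is a compact operator between the little Bloch-type spaces: it
maps the first into the second, as a linear operator that is compact for the norms. -/
def CesaroCompactLittle {X : Type*} [NormedAddCommGroup X] [NormedSpace ℂ X]
    (ω μ : NormalFunction) (φ : X → ℂ) : Prop :=
  ∃ S : littleBlochSpace X ω →L[ℂ] littleBlochSpace X μ,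
    (∀ f : littleBlochSpace X ω, ∀ z ∈ ball (0 : X) 1,
      (S f : BlochSpace X μ) z = cesaro φ (f : BlochSpace X ω) z) ∧
      IsCompactOperator S

end

/-! ### Holomorphic functions on balls: Taylor remainder, parameter integrals, holomorphy of
`radialDeriv f`. -/

section Holomorphic

variable {X : Type*} [NormedAddCommGroup X] [NormedSpace ℂ X]

/-! The key identity is `R(T_φ f) = f · Rφ`, with `T_φ f (0) = 0` (`radialDeriv_cesaro`,
`cesaro_zero`): the norm of `T_φ f` is the supremum of `μ |f| |Rφ|`. Integrability of `1/ω` makes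
every `f` in the domain bounded on the ball, `|f| ≤ C ‖f‖` (`exists_norm_apply_le`).

Necessity comes from the single test function `1`, since `T_φ 1 = φ - φ(0)` has the radial
derivative of `φ`.

For sufficiency, `μ |f| |Rφ| ≤ C ‖f‖ μ |Rφ|` tends to `0` at the boundary, so `T_φ` maps into the
little space and is bounded. For compactness take `f`, `g` in the unit ball of the domain. Where `μ
|Rφ|` is small, `μ |f - g| |Rφ|` is small because `|f - g| ≤ 2C`. The remaining points stay away
from the unit sphere, as `φ` is of little Bloch type, so they lie in some `E_{ε,ρ}` and hence in a
compact subset of the ball. There the uniformly bounded family is equicontinuous by Schwarz's lemma,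
so finitely many point values control `f - g` (`exists_finite_forall_norm_sub_le`). The image of the
unit ball is therefore totally bounded, and completeness of the target makes its closure compact.

The analytic groundwork has to work in any normed space: holomorphy of `T_φ f` and of `Rf`, and
term-by-term differentiation of series, all come from `hasFDerivAt_integral_of_norm_le`. -/

lemma mapsTo_closedBall_of_norm_le {X : Type*} [NormedAddCommGroup X] {f : X → ℂ} {c : X} {R B : ℝ} (hR : 0 < R)
    (hB : ∀ z ∈ ball c R, ‖f z‖ ≤ B) : MapsTo f (ball c R) (closedBall (f c) (2 * B)) := by
  intro z hz
  rw [mem_closedBall, dist_eq_norm]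
  linarith [norm_sub_le (f z) (f c), hB z hz, hB c (mem_ball_self hR)]

/-- Cauchy's estimate for the derivative. -/
lemma norm_fderiv_le_of_norm_le {f : X → ℂ} {c : X} {R B : ℝ} (hR : 0 < R)
    (hf : DifferentiableOn ℂ f (ball c R)) (hB : ∀ z ∈ ball c R, ‖f z‖ ≤ B) :
    ‖fderiv ℂ f c‖ ≤ 2 * B / R :=
  Complex.norm_fderiv_le_div_of_mapsTo_ball hf (mapsTo_closedBall_of_norm_le hR hB) hR

/-- The remainder of the first order Taylor expansion of a bounded holomorphic function. -/
lemma norm_sub_sub_fderiv_le {f : X → ℂ} {c v : X} {R B : ℝ} (hR : 0 < R)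
    (hf : DifferentiableOn ℂ f (ball c R)) (hB : ∀ z ∈ ball c R, ‖f z‖ ≤ B) (hv : ‖v‖ < R) :
    ‖f (c + v) - f c - fderiv ℂ f c v‖ ≤ 4 * B * (‖v‖ / R) ^ 2 := by
  have hfc : DifferentiableAt ℂ f c := hf.differentiableAt (ball_mem_nhds _ hR)
  -- Without its linear part, `f` agrees with `f c` to second order, so a higher order Schwarz lemma
  -- applies. The bound `4 * B` is `2 * B` for `f - f c` plus `2 * B` for the linear part, by
  -- Cauchy's estimate.
  set g : X → ℂ := fun z => f z - fderiv ℂ f c (z - c) with hg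
  have hgc : g c = f c := by simp [hg]
  have hgd : DifferentiableOn ℂ g (ball c R) := by
    refine hf.sub ?_
    exact ((fderiv ℂ f c).differentiable.comp (differentiable_id.sub_const c)).differentiableOn
  have hmaps : MapsTo g (ball c R) (closedBall (g c) (4 * B)) := by
    intro z hz
    have h1 := mapsTo_closedBall_of_norm_le hR hB hz
    have h2 := (fderiv ℂ f c).le_of_opNorm_le (norm_fderiv_le_of_norm_le hR hf hB) (z - c)
    have h3 : ‖z - c‖ ≤ R := by rw [← dist_eq_norm]; exact (mem_ball.1 hz).le
    have h0 : 0 ≤ B := (norm_nonneg _).trans (hB c (mem_ball_self hR))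
    have h4 : 2 * B / R * ‖z - c‖ ≤ 2 * B := by
      calc 2 * B / R * ‖z - c‖ ≤ 2 * B / R * R := by gcongr
        _ = 2 * B := by field_simp
    rw [mem_closedBall, dist_eq_norm] at *
    rw [hgc]
    have h5 : g z - f c = (f z - f c) - fderiv ℂ f c (z - c) := by simp [hg]; ring
    rw [h5]
    linarith [norm_sub_le (f z - f c) (fderiv ℂ f c (z - c))]
  -- Being `o` of the first power gives exponent `1 + 1 = 2` in the Schwarz bound.
  have hlit : (fun w => g w - g c) =o[𝓝 c] (fun w => ‖w - c‖ ^ 1) := by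
    have := hfc.hasFDerivAt.isLittleO
    simp only [pow_one]
    refine Asymptotics.IsLittleO.norm_right ?_
    refine this.congr_left fun w => ?_
    rw [hgc]; simp [hg]; ring
  have := Complex.dist_le_mul_div_pow_of_mapsTo_ball_of_isLittleO hgd hmaps hlit
    (z := c + v) (by simpa using hv)
  rw [dist_eq_norm, hgc, dist_eq_norm] at this
  simp only [hg, add_sub_cancel_left] at this
  rwa [sub_right_comm] at this

/-- Integrals of holomorphic functions depending on a parameter are holomorphic. -/
theorem hasFDerivAt_integral_of_norm_le {α : Type*} [MeasurableSpace α] {ν : Measure α}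
    {F : α → X → ℂ} {c : X} {R : ℝ} (hR : 0 < R) {b : α → ℝ} (hb : Integrable b ν)
    (hF : ∀ᵐ t ∂ν, DifferentiableOn ℂ (F t) (ball c R))
    (hm : ∀ z ∈ ball c R, AEStronglyMeasurable (fun t => F t z) ν)
    (hB : ∀ᵐ t ∂ν, ∀ z ∈ ball c R, ‖F t z‖ ≤ b t) :
    ∃ A : X →L[ℂ] ℂ, HasFDerivAt (fun z => ∫ t, F t z ∂ν) A c ∧
      ∀ v, A v = ∫ t, fderiv ℂ (F t) c v ∂ν := by
  -- The derivative in direction `v` is a pointwise limit of difference quotients along `s n → 0`;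
  -- the scale `e` keeps every `c + s n • v` inside the ball.
  have hmeas : ∀ v, AEStronglyMeasurable (fun t => fderiv ℂ (F t) c v) ν := by
    intro v
    obtain ⟨e, he, hev⟩ : ∃ e : ℝ, 0 < e ∧ e * ‖v‖ < R := by
      refine ⟨R / (‖v‖ + 1), by positivity, ?_⟩
      rw [div_mul_eq_mul_div, div_lt_iff₀ (by positivity)]
      nlinarith
    set s : ℕ → ℂ := fun n => (e : ℂ) * (1 / ((n : ℂ) + 1)) with hs
    have hs0 : ∀ n, s n ≠ 0 := fun n => by
      have : (n : ℂ) + 1 ≠ 0 := by exact_mod_cast n.succ_ne_zero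
      have : (e : ℂ) ≠ 0 := by exact_mod_cast he.ne'
      exact mul_ne_zero this (one_div_ne_zero ‹_›)
    have hst : Tendsto s atTop (𝓝 0) := by
      simpa [hs] using (tendsto_one_div_add_atTop_nhds_zero_nat (𝕜 := ℂ)).const_mul (e : ℂ)
    have hsn : ∀ n, ‖s n‖ ≤ e := fun n => by
      have h1 : ‖(n : ℂ) + 1‖ = n + 1 := by
        have : ((n : ℂ) + 1) = ((n + 1 : ℝ) : ℂ) := by push_cast; rfl
        rw [this, Complex.norm_real, Real.norm_of_nonneg (by positivity)]
      simp only [hs, norm_mul, norm_div, norm_one, h1, Complex.norm_real, Real.norm_of_nonneg he.le]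
      have : 1 / ((n : ℝ) + 1) ≤ 1 := by
        rw [div_le_one (by positivity)]; linarith [n.cast_nonneg (α := ℝ)]
      nlinarith
    refine aestronglyMeasurable_of_tendsto_ae atTop
      (f := fun n t => (s n)⁻¹ * (F t (c + s n • v) - F t c)) (fun n => ?_) ?_
    · refine ((hm _ ?_).sub (hm _ (mem_ball_self hR))).const_mul _
      simp only [mem_ball, dist_self_add_left, norm_smul]
      nlinarith [hsn n, norm_nonneg v]
    · filter_upwards [hF] with t ht
      have h1 := (ht.differentiableAt (ball_mem_nhds _ hR)).hasFDerivAt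
      have h2 : HasDerivAt (fun ζ : ℂ => c + ζ • v) v 0 := by
        simpa using ((hasDerivAt_id (0 : ℂ)).smul_const v).const_add c
      have h3 : HasDerivAt (fun ζ : ℂ => F t (c + ζ • v)) (fderiv ℂ (F t) c v) 0 :=
        HasFDerivAt.comp_hasDerivAt (0 : ℂ) (by simpa using h1) h2
      have h4 := h3.tendsto_slope_zero.comp
        (tendsto_nhdsWithin_iff.2 ⟨hst, Eventually.of_forall hs0⟩)
      simpa [Function.comp_def] using h4
  have hfb : ∀ᵐ t ∂ν, ‖fderiv ℂ (F t) c‖ ≤ 2 * b t / R := by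
    filter_upwards [hF, hB] with t h1 h2 using norm_fderiv_le_of_norm_le hR h1 h2
  have hint : ∀ v, Integrable (fun t => fderiv ℂ (F t) c v) ν := by
    intro v
    refine ((hb.const_mul 2).div_const R |>.mul_const ‖v‖).mono' (hmeas v) ?_
    filter_upwards [hfb] with t ht using (fderiv ℂ (F t) c).le_of_opNorm_le ht v
  have hFint : ∀ z ∈ ball c R, Integrable (fun t => F t z) ν := fun z hz => by
    refine hb.mono' (hm z hz) ?_
    filter_upwards [hB] with t ht using ht z hz
  let L : X →ₗ[ℂ] ℂ :=
    { toFun := fun v => ∫ t, fderiv ℂ (F t) c v ∂ν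
      map_add' := fun v w => by simp [integral_add (hint v) (hint w)]
      map_smul' := fun a v => by simp [integral_const_mul] }
  let A : X →L[ℂ] ℂ := L.mkContinuous ((∫ t, 2 * b t / R ∂ν)) fun v => by
    rw [← integral_mul_const]
    refine norm_integral_le_of_norm_le (((hb.const_mul 2).div_const R).mul_const ‖v‖) ?_
    filter_upwards [hfb] with t ht using (fderiv ℂ (F t) c).le_of_opNorm_le ht v
  refine ⟨A, ?_, fun v => rfl⟩
  rw [hasFDerivAt_iff_isLittleO_nhds_zero]
  -- Integrating the Taylor remainder bound `4 * b t * (‖v‖ / R) ^ 2` gives an `O(‖v‖ ^ 2)` error at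
  -- once.
  have hO : (fun v => (∫ t, F t (c + v) ∂ν) - (∫ t, F t c ∂ν) - A v) =O[𝓝 0]
      fun v => ‖v‖ ^ 2 := by
    refine Asymptotics.IsBigO.of_bound (∫ t, 4 * b t * (1 / R) ^ 2 ∂ν) ?_
    filter_upwards [ball_mem_nhds (0 : X) hR] with v hv
    have hv' : ‖v‖ < R := by simpa using hv
    have e : (∫ t, F t (c + v) ∂ν) - (∫ t, F t c ∂ν) - A v
        = ∫ t, (F t (c + v) - F t c - fderiv ℂ (F t) c v) ∂ν := by
      have h1 := hFint (c + v) (by simpa using hv')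
      have h2 := hFint c (mem_ball_self hR)
      have h3 : A v = ∫ t, fderiv ℂ (F t) c v ∂ν := rfl
      rw [h3, ← integral_sub h1 h2]
      exact (integral_sub (h1.sub h2) (hint v)).symm
    rw [e, ← integral_mul_const]
    refine norm_integral_le_of_norm_le (((hb.const_mul 4).mul_const _).mul_const _) ?_
    filter_upwards [hF, hB] with t h1 h2
    refine (norm_sub_sub_fderiv_le hR h1 h2 hv').trans_eq ?_
    rw [norm_pow, norm_norm]; ring
  exact hO.trans_isLittleO
    (((Asymptotics.isLittleO_pow_id (𝕜 := ℝ) one_lt_two).comp_tendsto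
      (tendsto_norm_zero (E := X))).trans_isBigO (Asymptotics.isBigO_norm_left.2 (Asymptotics.isBigO_refl _ _)))

lemma radialDeriv_eq_deriv {f : X → ℂ} (hf : DifferentiableOn ℂ f (ball 0 1)) {z : X}
    (hz : z ∈ ball (0 : X) 1) : radialDeriv f z = deriv (fun ζ : ℂ => f (ζ • z)) 1 := by
  have := (hasDerivAt_slice hf z (ζ := 1) (by simpa using hz)).deriv
  simpa [radialDeriv] using this.symm

/-- The radial derivative of a holomorphic function is holomorphic. -/
theorem differentiableOn_radialDeriv {f : X → ℂ} (hf : DifferentiableOn ℂ f (ball 0 1)) :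
    DifferentiableOn ℂ (radialDeriv f) (ball 0 1) := by
  intro z₀ hz₀
  -- Continuity of `f` at `z₀` provides one bound valid for all `ζ • z` with `(ζ, z)` near `(1,
  -- z₀)`; this will dominate the Cauchy integral.
  have hev : ∀ᶠ p : ℂ × X in 𝓝 (1, z₀), p.1 • p.2 ∈ ball (0 : X) 1 ∧
      ‖f (p.1 • p.2)‖ < ‖f z₀‖ + 1 := by
    have h1 : Tendsto (fun p : ℂ × X => p.1 • p.2) (𝓝 (1, z₀)) (𝓝 z₀) := by
      have : Continuous (fun p : ℂ × X => p.1 • p.2) := by fun_prop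
      simpa using this.tendsto (1, z₀)
    have h2 : Tendsto (fun p : ℂ × X => ‖f (p.1 • p.2)‖) (𝓝 (1, z₀)) (𝓝 ‖f z₀‖) :=
      ((differentiableAt_of_ball hf hz₀).continuousAt.tendsto.comp h1).norm
    exact (h1.eventually (isOpen_ball.mem_nhds hz₀)).and
      (h2.eventually (gt_mem_nhds (lt_add_one _)))
  obtain ⟨r, hr, hball⟩ := Metric.eventually_nhds_iff_ball.1 hev
  set q := r / 2 with hq
  have hq0 : 0 < q := by positivity
  have hp : ∀ ζ ∈ closedBall (1 : ℂ) q, ∀ z ∈ ball z₀ r, ζ • z ∈ ball (0 : X) 1 ∧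
      ‖f (ζ • z)‖ < ‖f z₀‖ + 1 := fun ζ hζ z hz => hball (ζ, z) (by
    rw [← ball_prod_same]
    exact ⟨closedBall_subset_ball (by linarith) hζ, hz⟩)
  -- Up to the factor `1 / (2πi)`, this is the integrand of Cauchy's formula for the derivative of
  -- `ζ ↦ f (ζ • z)` at `ζ = 1`, which is `Rf(z)`. It involves only values of `f`, so it is
  -- holomorphic in `z`.
  set F : ℝ → X → ℂ := fun θ z =>
    deriv (circleMap 1 q) θ • ((1 / (circleMap 1 q θ - 1) ^ 2) • f (circleMap 1 q θ • z)) with hFdef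
  have hcm : ∀ θ, circleMap 1 q θ ∈ closedBall (1 : ℂ) q :=
    fun θ => circleMap_mem_closedBall _ hq0.le _
  have hcm' : ∀ θ, ‖circleMap 1 q θ - 1‖ = q := fun θ => by
    rw [← dist_eq_norm]; exact circleMap_mem_sphere (1 : ℂ) hq0.le θ
  have hd : ∀ θ, DifferentiableOn ℂ (F θ) (ball z₀ r) := by
    intro θ z hz
    have : DifferentiableAt ℂ f (circleMap 1 q θ • z) :=
      differentiableAt_of_ball hf (hp _ (hcm θ) z hz).1
    have h2 : DifferentiableAt ℂ (fun z => f (circleMap 1 q θ • z)) z :=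
      DifferentiableAt.comp z this (differentiableAt_id.const_smul _)
    exact ((h2.const_smul (1 / (circleMap 1 q θ - 1) ^ 2)).const_smul
      (deriv (circleMap 1 q) θ)).differentiableWithinAt
  have hm : ∀ z ∈ ball z₀ r, AEStronglyMeasurable (fun θ => F θ z)
      (volume.restrict (Ioc 0 (2 * Real.pi))) := by
    intro z hz
    refine Continuous.aestronglyMeasurable ?_
    have h1 : Continuous fun θ => f (circleMap 1 q θ • z) := by
      refine continuous_iff_continuousAt.2 fun θ => ?_
      exact ContinuousAt.comp (f := fun θ => circleMap 1 q θ • z)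
        (differentiableAt_of_ball hf (hp _ (hcm θ) z hz).1).continuousAt
        ((continuous_circleMap 1 q).smul continuous_const).continuousAt
    have h2 : Continuous fun θ => 1 / (circleMap 1 q θ - 1) ^ 2 := by
      refine continuous_const.div (((continuous_circleMap 1 q).sub continuous_const).pow 2) ?_
      intro θ
      have := hcm' θ
      exact pow_ne_zero 2 (norm_ne_zero_iff.1 (by rw [this]; exact hq0.ne'))
    have h3 : Continuous fun θ => deriv (circleMap 1 q) θ := by
      simp only [deriv_circleMap]
      exact (continuous_circleMap 0 q).mul continuous_const
    exact h3.smul (h2.smul h1)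
  have hb : ∀ θ, ∀ z ∈ ball z₀ r, ‖F θ z‖ ≤ q * (1 / q ^ 2 * (‖f z₀‖ + 1)) := by
    intro θ z hz
    simp only [hFdef, norm_smul, norm_div, norm_pow, hcm', norm_one, deriv_circleMap, norm_mul,
      norm_circleMap_zero, Complex.norm_I, mul_one, abs_of_pos hq0]
    gcongr
    exact (hp _ (hcm θ) z hz).2.le
  obtain ⟨A, hA, -⟩ := hasFDerivAt_integral_of_norm_le hr (integrable_const _)
    (Eventually.of_forall hd) hm (Eventually.of_forall hb)
  have hev2 : radialDeriv f =ᶠ[𝓝 z₀] fun z => (2 * Real.pi * Complex.I)⁻¹ *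
      ∫ θ, F θ z ∂(volume.restrict (Ioc 0 (2 * Real.pi))) := by
    filter_upwards [ball_mem_nhds z₀ hr] with z hz
    have hz1 : z ∈ ball (0 : X) 1 := by
      simpa using (hp 1 (mem_closedBall_self hq0.le) z hz).1
    have hd : DiffContOnCl ℂ (fun ζ : ℂ => f (ζ • z)) (ball 1 q) := by
      refine DifferentiableOn.diffContOnCl fun ζ hζ => ?_
      exact (hasDerivAt_slice hf z
        (hp ζ (closure_ball_subset_closedBall hζ) z hz).1).differentiableAt.differentiableWithinAt
    have h1 := hd.deriv_eq_smul_circleIntegral hq0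
    rw [radialDeriv_eq_deriv hf hz1, ← intervalIntegral.integral_of_le (by positivity)]
    have h2 : (2 * (Real.pi : ℂ) * Complex.I) ≠ 0 := Complex.two_pi_I_ne_zero
    rw [eq_inv_mul_iff_mul_eq₀ h2, ← smul_eq_mul, ← h1]
    rfl
  exact ((hA.differentiableAt.const_mul _).congr_of_eventuallyEq hev2).differentiableWithinAt

end Holomorphic

/-! ### Growth estimates for `f` in terms of `Rf`. -/

section Growth

variable {X : Type*} [NormedAddCommGroup X] [NormedSpace ℂ X]

lemma radialDeriv_zero (f : X → ℂ) : radialDeriv f 0 = 0 := by simp [radialDeriv]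

lemma radialDeriv_congr {f g : X → ℂ} (h : EqOn f g (ball 0 1)) {z : X}
    (hz : z ∈ ball (0 : X) 1) : radialDeriv f z = radialDeriv g z := by
  rw [radialDeriv, radialDeriv, (h.eventuallyEq_of_mem (isOpen_ball.mem_nhds hz)).fderiv_eq]

lemma smul_mem_unit_ball {z : X} (hz : z ∈ ball (0 : X) 1) {ζ : ℂ} (hζ : ‖ζ‖ ≤ 1) :
    ζ • z ∈ ball (0 : X) 1 := by
  simp only [mem_ball, dist_zero_right, norm_smul] at *
  nlinarith [norm_nonneg z]

lemma ofReal_smul_mem_unit_ball {z : X} (hz : z ∈ ball (0 : X) 1) {t : ℝ} (ht : t ∈ Icc (0 : ℝ) 1) :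
    (t : ℂ) • z ∈ ball (0 : X) 1 :=
  smul_mem_unit_ball hz (by rw [Complex.norm_real, Real.norm_of_nonneg ht.1]; exact ht.2)

/-- This is the derivative of a holomorphic function of one complex variable, so continuity of
`fderiv ℂ f` on `X` is not needed. -/
lemma continuousOn_fderiv_slice {f : X → ℂ} (hf : DifferentiableOn ℂ f (ball 0 1)) (u : X) :
    ContinuousOn (fun ζ : ℂ => fderiv ℂ f (ζ • u) u) {ζ : ℂ | ζ • u ∈ ball (0 : X) 1} := by
  have ho : IsOpen {ζ : ℂ | ζ • u ∈ ball (0 : X) 1} :=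
    isOpen_ball.preimage (continuous_id.smul continuous_const)
  have h1 : DifferentiableOn ℂ (fun ζ : ℂ => f (ζ • u)) {ζ : ℂ | ζ • u ∈ ball (0 : X) 1} :=
    fun ζ hζ => (hasDerivAt_slice hf u hζ).differentiableAt.differentiableWithinAt
  exact (h1.deriv ho).continuousOn.congr fun ζ hζ => (hasDerivAt_slice hf u hζ).deriv.symm

lemma radialDeriv_ofReal_smul (f : X → ℂ) (t : ℝ) (z : X) :
    radialDeriv f ((t : ℂ) • z) = t * fderiv ℂ f ((t : ℂ) • z) z := by
  simp [radialDeriv]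

/-- Integrate the derivative along the segment from `0` to `z`. Since `Rf(tz) = t Df(tz)z`, the
factor `t` in the hypothesis cancels. -/
lemma norm_sub_le_integral_of_norm_radialDeriv_le {f : X → ℂ}
    (hf : DifferentiableOn ℂ f (ball 0 1)) {z : X} (hz : z ∈ ball (0 : X) 1) {g : ℝ → ℝ}
    (hg : IntervalIntegrable g volume 0 1)
    (h : ∀ t ∈ Ioc (0 : ℝ) 1, ‖radialDeriv f ((t : ℂ) • z)‖ ≤ t * g t) :
    ‖f z - f 0‖ ≤ ∫ t in (0 : ℝ)..1, g t := by
  have hc : ContinuousOn (fun t : ℝ => fderiv ℂ f ((t : ℂ) • z) z) (Icc 0 1) :=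
    (continuousOn_fderiv_slice hf z).comp Complex.continuous_ofReal.continuousOn
      fun t ht => ofReal_smul_mem_unit_ball hz ht
  have h1 := intervalIntegral.integral_eq_sub_of_hasDerivAt (a := 0) (b := 1)
    (f := fun t : ℝ => f ((t : ℂ) • z)) (f' := fun t : ℝ => fderiv ℂ f ((t : ℂ) • z) z)
    (fun t ht => (hasDerivAt_slice hf z (ofReal_smul_mem_unit_ball hz
      (by rwa [uIcc_of_le zero_le_one] at ht))).comp_ofReal)
    (ContinuousOn.intervalIntegrable (by rwa [uIcc_of_le zero_le_one]))
  have h2 : f z - f 0 = ∫ t in (0 : ℝ)..1, fderiv ℂ f ((t : ℂ) • z) z := by simpa using h1.symm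
  rw [h2]
  refine intervalIntegral.norm_integral_le_of_norm_le zero_le_one ?_ hg
  refine Eventually.of_forall fun t ht => ?_
  have h3 := h t ht
  rw [radialDeriv_ofReal_smul, norm_mul, Complex.norm_real, Real.norm_of_nonneg ht.1.le] at h3
  exact le_of_mul_le_mul_left h3 ht.1

lemma NormalFunction.exists_one_div_le (ω : NormalFunction) {r : ℝ} (hr : r < 1) :
    ∃ C : ℝ, 0 ≤ C ∧ ∀ t ∈ Icc 0 r, 1 / ω t ≤ C := by
  have hc : ContinuousOn (fun t => 1 / ω t) (Icc 0 r) :=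
    continuousOn_const.div (ω.continuousOn.mono (Icc_subset_Ico_right hr))
      fun t ht => (ω.pos t ⟨ht.1, ht.2.trans_lt hr⟩).ne'
  obtain ⟨C, hC⟩ := isCompact_Icc.bddAbove_image hc
  exact ⟨max C 0, le_max_right _ _, fun t ht => (hC ⟨t, ht, rfl⟩).trans (le_max_left _ _)⟩

/-- On smaller balls, `|Rf(z)|` is bounded by a multiple of `‖z‖`. -/
lemma NormalFunction.exists_norm_radialDeriv_le (X : Type*) [NormedAddCommGroup X]
    [NormedSpace ℂ X] (ω : NormalFunction) {r : ℝ} (hr : r < 1) :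
    ∃ C : ℝ, 0 ≤ C ∧ ∀ (f : X → ℂ) (N : ℝ), DifferentiableOn ℂ f (ball 0 1) →
      (∀ z ∈ ball (0 : X) 1, ω ‖z‖ * ‖radialDeriv f z‖ ≤ N) →
      ∀ z : X, ‖z‖ ≤ r → ‖radialDeriv f z‖ ≤ C * N * ‖z‖ := by
  obtain ⟨s, hs, hs1⟩ := exists_between (max_lt hr (zero_lt_one' ℝ))
  have hs0 : 0 < s := (le_max_right _ _).trans_lt hs
  have hrs : r < s := (le_max_left _ _).trans_lt hs
  obtain ⟨C, hC0, hC⟩ := ω.exists_one_div_le hs1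
  refine ⟨C / s, by positivity, fun f N hf hN z hz => ?_⟩
  have hN0 : 0 ≤ N := by
    have := hN 0 (by simp)
    simpa [radialDeriv_zero] using this
  have hsub : ball (0 : X) s ⊆ ball 0 1 := ball_subset_ball hs1.le
  -- Schwarz's lemma on the ball of radius `s`: `Rf` is holomorphic, vanishes at `0` and is bounded
  -- there by `C * N`.
  have hmaps : MapsTo (radialDeriv f) (ball 0 s) (closedBall (radialDeriv f 0) (C * N)) := by
    intro w hw
    rw [radialDeriv_zero, mem_closedBall_zero_iff]
    have h1 := hN w (hsub hw)
    have h2 := normalFunction_pos ω (hsub hw)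
    have h3 := hC ‖w‖ ⟨norm_nonneg w, by simpa using (mem_ball_zero_iff.1 hw).le⟩
    calc ‖radialDeriv f w‖ = 1 / ω ‖w‖ * (ω ‖w‖ * ‖radialDeriv f w‖) := by field_simp
      _ ≤ C * N := by gcongr
  have := Complex.dist_le_div_mul_dist_of_mapsTo_ball
    ((differentiableOn_radialDeriv hf).mono hsub) hmaps
    (mem_ball_zero_iff.2 (hz.trans_lt hrs))
  rw [radialDeriv_zero, dist_zero_right, dist_zero_right] at this
  refine this.trans_eq ?_
  ring

variable {ω : NormalFunction}

lemma norm_zero_le_norm (f : BlochSpace X ω) : ‖f 0‖ ≤ ‖f‖ := by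
  rw [blochSpace_norm_def]
  exact le_add_of_nonneg_right (Real.iSup_nonneg fun z =>
    mul_nonneg (normalFunction_pos ω z.2).le (norm_nonneg _))

lemma mul_norm_radialDeriv_le_norm (f : BlochSpace X ω) {z : X} (hz : z ∈ ball (0 : X) 1) :
    ω ‖z‖ * ‖radialDeriv f z‖ ≤ ‖f‖ := by
  rw [blochSpace_norm_def]
  exact (le_ciSup f.2.1.2 ⟨z, hz⟩).trans (le_add_of_nonneg_left (norm_nonneg _))

lemma blochSpace_norm_le {f : BlochSpace X ω} {a b : ℝ} (h0 : ‖f 0‖ ≤ a)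
    (h : ∀ z ∈ ball (0 : X) 1, ω ‖z‖ * ‖radialDeriv f z‖ ≤ b) : ‖f‖ ≤ a + b := by
  have : Nonempty (ball (0 : X) 1) := ⟨⟨0, by simp⟩⟩
  rw [blochSpace_norm_def]
  exact add_le_add h0 (ciSup_le fun z => h z z.2)

/-- The linear bound on `Rf` near `0` absorbs the division by `t` in the radial integral. As `1/ω`
need not be integrable here, this also serves the completeness of the target space. -/
lemma exists_norm_apply_le_on_smaller_ball (X : Type*) [NormedAddCommGroup X] [NormedSpace ℂ X]
    (ω : NormalFunction) {r : ℝ} (hr : r < 1) :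
    ∃ C : ℝ, 0 ≤ C ∧ ∀ (f : BlochSpace X ω) (z : X), ‖z‖ ≤ r → ‖f z‖ ≤ C * ‖f‖ := by
  obtain ⟨C, hC0, hC⟩ := ω.exists_norm_radialDeriv_le X hr
  refine ⟨1 + C, by positivity, fun f z hz => ?_⟩
  have hz1 : z ∈ ball (0 : X) 1 := mem_ball_zero_iff.2 (hz.trans_lt hr)
  have h1 : ‖f z - f 0‖ ≤ ∫ t in (0 : ℝ)..1, C * ‖f‖ := by
    refine norm_sub_le_integral_of_norm_radialDeriv_le f.2.1.1 hz1 (by simp) fun t ht => ?_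
    have h2 : ‖(t : ℂ) • z‖ = t * ‖z‖ := by
      rw [norm_smul, Complex.norm_real, Real.norm_of_nonneg ht.1.le]
    have h3 : t * ‖z‖ ≤ t := mul_le_of_le_one_right ht.1.le (hz.trans hr.le)
    have h4 : t * ‖z‖ ≤ r := (mul_le_of_le_one_left (norm_nonneg z) ht.2).trans hz
    refine (hC f ‖f‖ f.2.1.1 (fun w hw => mul_norm_radialDeriv_le_norm f hw) _
      (h2.trans_le h4)).trans ?_
    rw [h2, mul_comm t (C * ‖f‖)]
    exact mul_le_mul_of_nonneg_left h3 (mul_nonneg hC0 (norm_nonneg f))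
  have h2 := norm_zero_le_norm f
  have h3 : ‖f z‖ ≤ ‖f z - f 0‖ + ‖f 0‖ := by rw [add_comm]; exact norm_le_insert' (f z) (f 0)
  simp at h1
  linarith

/-- If `1/ω` is integrable, then Bloch-type functions are bounded. -/
lemma exists_norm_apply_le (X : Type*) [NormedAddCommGroup X] [NormedSpace ℂ X]
    {ω : NormalFunction} (hω : IntegrableOn (fun t : ℝ => 1 / ω t) (Ioo (0 : ℝ) 1)) :
    ∃ C : ℝ, 0 ≤ C ∧ ∀ (f : BlochSpace X ω), ∀ z ∈ ball (0 : X) 1, ‖f z‖ ≤ C * ‖f‖ := by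
  -- The radius `1 / 2` splits the ray: inside it Schwarz's linear bound supplies the factor `t`,
  -- outside it `1 ≤ 2 * (t * ‖z‖)` does. The integrand below is the sum of both bounds.
  obtain ⟨C, hC0, hC⟩ := ω.exists_norm_radialDeriv_le X (r := 1 / 2) (by norm_num)
  set I := ∫ t in Ioo (0 : ℝ) 1, 1 / ω t with hI
  have hI0 : 0 ≤ I := setIntegral_nonneg measurableSet_Ioo fun t ht =>
    one_div_nonneg.2 (ω.pos t ⟨ht.1.le, ht.2⟩).le
  refine ⟨1 + (C + 2 * I), by positivity, fun f z hz => ?_⟩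
  have hz1 : ‖z‖ < 1 := mem_ball_zero_iff.1 hz
  have hpos : ∀ t ∈ Icc (0 : ℝ) 1, t * ‖z‖ ∈ Ico (0 : ℝ) 1 := fun t ht =>
    ⟨mul_nonneg ht.1 (norm_nonneg z),
      (mul_le_of_le_one_left (norm_nonneg z) ht.2).trans_lt hz1⟩
  have hcont : ContinuousOn (fun t : ℝ => 1 / ω (t * ‖z‖)) (Icc 0 1) := by
    refine continuousOn_const.div (ω.continuousOn.comp (by fun_prop) hpos) fun t ht => ?_
    exact (ω.pos _ (hpos t ht)).ne'
  have hii : IntervalIntegrable (fun t : ℝ => 1 / ω (t * ‖z‖)) volume 0 1 :=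
    ContinuousOn.intervalIntegrable (by rwa [uIcc_of_le zero_le_one])
  have h1 : ‖f z - f 0‖ ≤
      ∫ t in (0 : ℝ)..1, (C * ‖f‖ + 2 * ‖f‖ * ‖z‖ * (1 / ω (t * ‖z‖))) := by
    refine norm_sub_le_integral_of_norm_radialDeriv_le f.2.1.1 hz
      ((by simp : IntervalIntegrable (fun _ => C * ‖f‖) volume 0 1).add (hii.const_mul _))
      fun t ht => ?_
    have htz := ofReal_smul_mem_unit_ball hz ⟨ht.1.le, ht.2⟩
    have h2 : ‖(t : ℂ) • z‖ = t * ‖z‖ := by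
      rw [norm_smul, Complex.norm_real, Real.norm_of_nonneg ht.1.le]
    have hωt := ω.pos _ (hpos t ⟨ht.1.le, ht.2⟩)
    have hn := norm_nonneg f
    have ht0 := ht.1
    rcases le_or_gt (t * ‖z‖) (1 / 2) with h | h
    · have h3 := hC f ‖f‖ f.2.1.1 (fun w hw => mul_norm_radialDeriv_le_norm f hw) _ (h2.trans_le h)
      have h4 : t * ‖z‖ ≤ t := mul_le_of_le_one_right ht.1.le hz1.le
      rw [h2] at h3
      have h5 : C * ‖f‖ * (t * ‖z‖) ≤ C * ‖f‖ * t := by gcongr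
      have h6 : 0 ≤ t * (2 * ‖f‖ * ‖z‖ * (1 / ω (t * ‖z‖))) := by positivity
      linarith
    · have h3 := mul_norm_radialDeriv_le_norm f htz
      rw [h2] at h3
      have h4 : ‖radialDeriv f ((t : ℂ) • z)‖ ≤ ‖f‖ * (1 / ω (t * ‖z‖)) := by
        rw [mul_one_div, le_div_iff₀ hωt]; linarith
      have h5 : 1 * (‖f‖ * (1 / ω (t * ‖z‖))) ≤
          (2 * (t * ‖z‖)) * (‖f‖ * (1 / ω (t * ‖z‖))) := by
        gcongr; linarith
      have h6 : 0 ≤ t * (C * ‖f‖) := by positivity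
      linarith
  -- Substituting `u = t * ‖z‖` uses up the factor `‖z‖` and leaves the integral of `1/ω` over `[0,
  -- ‖z‖]`.
  have h2 : ‖z‖ * ∫ t in (0 : ℝ)..1, 1 / ω (t * ‖z‖) ≤ I := by
    rw [intervalIntegral.mul_integral_comp_mul_right (f := fun t => 1 / ω t), zero_mul, one_mul,
      intervalIntegral.integral_of_le (norm_nonneg z)]
    refine setIntegral_mono_set hω ?_ (Eventually.of_forall fun t ht => ⟨ht.1, ht.2.trans_lt hz1⟩)
    filter_upwards [ae_restrict_mem measurableSet_Ioo] with t ht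
    exact one_div_nonneg.2 (ω.pos t ⟨ht.1.le, ht.2⟩).le
  rw [intervalIntegral.integral_add (by simp) (hii.const_mul _),
    intervalIntegral.integral_const_mul (2 * ‖f‖ * ‖z‖)]
    at h1
  have h3 := norm_zero_le_norm f
  have h4 : ‖f z‖ ≤ ‖f z - f 0‖ + ‖f 0‖ := by rw [add_comm]; exact norm_le_insert' (f z) (f 0)
  have h5 := mul_le_mul_of_nonneg_left h2 (norm_nonneg f)
  simp only [intervalIntegral.integral_const, sub_zero, one_smul] at h1
  linarith

end Growth

/-! ### The extended Cesàro operator and its radial derivative. -/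

section Cesaro

variable {X : Type*} [NormedAddCommGroup X] [NormedSpace ℂ X]

lemma cesaro_zero (φ f : X → ℂ) : cesaro φ f 0 = 0 := by
  simp [cesaro, radialDeriv_zero]

lemma continuousOn_cesaro_slice {φ f : X → ℂ} (hφ : DifferentiableOn ℂ φ (ball 0 1))
    (hf : DifferentiableOn ℂ f (ball 0 1)) (z : X) :
    ContinuousOn (fun t : ℝ => f ((t : ℂ) • z) * fderiv ℂ φ ((t : ℂ) • z) z)
      {t : ℝ | (t : ℂ) • z ∈ ball (0 : X) 1} := by
  refine ContinuousOn.mul (hf.continuousOn.comp (by fun_prop) fun t ht => ht) ?_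
  exact (continuousOn_fderiv_slice hφ z).comp Complex.continuous_ofReal.continuousOn fun t ht => ht

lemma cesaro_eq_integral_fderiv (φ f : X → ℂ) (z : X) :
    cesaro φ f z = ∫ t in (0 : ℝ)..1, f ((t : ℂ) • z) * fderiv ℂ φ ((t : ℂ) • z) z := by
  refine intervalIntegral.integral_congr_ae (Eventually.of_forall fun t ht => ?_)
  rw [uIoc_of_le zero_le_one] at ht
  have : (t : ℂ) ≠ 0 := by exact_mod_cast ht.1.ne'
  rw [radialDeriv_ofReal_smul]
  field_simp

lemma cesaro_one {φ : X → ℂ} (hφ : DifferentiableOn ℂ φ (ball 0 1)) {z : X}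
    (hz : z ∈ ball (0 : X) 1) {f : X → ℂ} (hf : ∀ w ∈ ball (0 : X) 1, f w = 1) :
    cesaro φ f z = φ z - φ 0 := by
  have hc : ContinuousOn (fun t : ℝ => fderiv ℂ φ ((t : ℂ) • z) z) (Icc 0 1) :=
    (continuousOn_fderiv_slice hφ z).comp Complex.continuous_ofReal.continuousOn
      fun t ht => ofReal_smul_mem_unit_ball hz ht
  have h1 := intervalIntegral.integral_eq_sub_of_hasDerivAt (a := 0) (b := 1)
    (f := fun t : ℝ => φ ((t : ℂ) • z)) (f' := fun t : ℝ => fderiv ℂ φ ((t : ℂ) • z) z)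
    (fun t ht => (hasDerivAt_slice hφ z (ofReal_smul_mem_unit_ball hz
      (by rwa [uIcc_of_le zero_le_one] at ht))).comp_ofReal)
    (ContinuousOn.intervalIntegrable (by rwa [uIcc_of_le zero_le_one]))
  rw [cesaro_eq_integral_fderiv]
  simp only [Complex.ofReal_one, one_smul, Complex.ofReal_zero, zero_smul] at h1
  rw [← h1]
  refine intervalIntegral.integral_congr fun t ht => ?_
  rw [uIcc_of_le zero_le_one] at ht
  simp only [hf _ (ofReal_smul_mem_unit_ball hz ht), one_mul]

lemma cesaro_add {φ f g : X → ℂ} (hφ : DifferentiableOn ℂ φ (ball 0 1))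
    (hf : DifferentiableOn ℂ f (ball 0 1)) (hg : DifferentiableOn ℂ g (ball 0 1)) {z : X}
    (hz : z ∈ ball (0 : X) 1) : cesaro φ (f + g) z = cesaro φ f z + cesaro φ g z := by
  have hi : ∀ h : X → ℂ, DifferentiableOn ℂ h (ball 0 1) → IntervalIntegrable
      (fun t : ℝ => h ((t : ℂ) • z) * fderiv ℂ φ ((t : ℂ) • z) z) volume 0 1 := fun h hh => by
    refine ContinuousOn.intervalIntegrable ((continuousOn_cesaro_slice hφ hh z).mono ?_)
    rw [uIcc_of_le zero_le_one]
    exact fun t ht => ofReal_smul_mem_unit_ball hz ht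
  simp only [cesaro_eq_integral_fderiv, Pi.add_apply, add_mul]
  exact intervalIntegral.integral_add (hi f hf) (hi g hg)

lemma cesaro_smul (φ f : X → ℂ) (c : ℂ) (z : X) : cesaro φ (c • f) z = c * cesaro φ f z := by
  simp only [cesaro, Pi.smul_apply, smul_eq_mul, mul_assoc]
  exact intervalIntegral.integral_const_mul _ _

/-- The extended Cesàro operator maps bounded holomorphic functions to holomorphic functions. -/
theorem differentiableOn_cesaro {μ : NormalFunction} {φ f : X → ℂ} (hφ : MemBloch μ φ)
    (hf : DifferentiableOn ℂ f (ball 0 1)) {B : ℝ} (hB : ∀ z ∈ ball (0 : X) 1, ‖f z‖ ≤ B) :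
    DifferentiableOn ℂ (cesaro φ f) (ball 0 1) := by
  intro z₀ hz₀
  have hz₀' : ‖z₀‖ < 1 := mem_ball_zero_iff.1 hz₀
  obtain ⟨r, hr, hr1⟩ := exists_between hz₀'
  obtain ⟨N, hN⟩ := hφ.2
  obtain ⟨C, hC0, hC⟩ := μ.exists_norm_radialDeriv_le X hr1
  have hN0 : 0 ≤ N := by
    have := hN ⟨⟨0, by simp⟩, rfl⟩
    simpa [radialDeriv_zero] using this
  have hB0 : 0 ≤ B := (norm_nonneg _).trans (hB 0 (by simp))
  have hbr : ∀ z ∈ ball z₀ (r - ‖z₀‖), ‖z‖ ≤ r := fun z hz => by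
    rw [mem_ball, dist_eq_norm] at hz
    linarith [norm_le_insert' z z₀]
  have hb1 : ∀ z ∈ ball z₀ (r - ‖z₀‖), z ∈ ball (0 : X) 1 := fun z hz =>
    mem_ball_zero_iff.2 ((hbr z hz).trans_lt hr1)
  set F : ℝ → X → ℂ := fun t z =>
    f ((t : ℂ) • z) * radialDeriv φ ((t : ℂ) • z) * (1 / (t : ℂ)) with hF
  have hd : ∀ᵐ t ∂(volume.restrict (Ioc (0 : ℝ) 1)),
      DifferentiableOn ℂ (F t) (ball z₀ (r - ‖z₀‖)) := by
    filter_upwards [ae_restrict_mem measurableSet_Ioc] with t ht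
    have hm : MapsTo (fun z : X => (t : ℂ) • z) (ball z₀ (r - ‖z₀‖)) (ball 0 1) := fun z hz =>
      ofReal_smul_mem_unit_ball (hb1 z hz) ⟨ht.1.le, ht.2⟩
    have hl : DifferentiableOn ℂ (fun z : X => (t : ℂ) • z) (ball z₀ (r - ‖z₀‖)) :=
      differentiableOn_id.const_smul (t : ℂ)
    exact ((hf.comp hl hm).mul ((differentiableOn_radialDeriv hφ.1).comp hl hm)).mul_const _
  have hm : ∀ z ∈ ball z₀ (r - ‖z₀‖),
      AEStronglyMeasurable (fun t => F t z) (volume.restrict (Ioc (0 : ℝ) 1)) := by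
    intro z hz
    refine ContinuousOn.aestronglyMeasurable ?_ measurableSet_Ioc
    have hm : MapsTo (fun t : ℝ => (t : ℂ) • z) (Ioc 0 1) (ball 0 1) := fun t ht =>
      ofReal_smul_mem_unit_ball (hb1 z hz) ⟨ht.1.le, ht.2⟩
    have hl : ContinuousOn (fun t : ℝ => (t : ℂ) • z) (Ioc 0 1) := by fun_prop
    refine ((hf.continuousOn.comp hl hm).mul
      ((differentiableOn_radialDeriv hφ.1).continuousOn.comp hl hm)).mul
      (continuousOn_const.div Complex.continuous_ofReal.continuousOn fun t ht => ?_)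
    exact_mod_cast ht.1.ne'
  -- The singularity `1/t` is harmless: `|Rφ(tz)| ≤ C * N * t * ‖z‖` by the Schwarz-type bound.
  have hb : ∀ᵐ t ∂(volume.restrict (Ioc (0 : ℝ) 1)), ∀ z ∈ ball z₀ (r - ‖z₀‖),
      ‖F t z‖ ≤ B * (C * N) := by
    filter_upwards [ae_restrict_mem measurableSet_Ioc] with t ht z hz
    have htz := ofReal_smul_mem_unit_ball (hb1 z hz) ⟨ht.1.le, ht.2⟩
    have ht0 := ht.1
    have h2 : ‖(t : ℂ) • z‖ = t * ‖z‖ := by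
      rw [norm_smul, Complex.norm_real, Real.norm_of_nonneg ht.1.le]
    have h3 : t * ‖z‖ ≤ r := (mul_le_of_le_one_left (norm_nonneg z) ht.2).trans (hbr z hz)
    have h4 := hC φ N hφ.1 (fun w hw => hN ⟨⟨w, hw⟩, rfl⟩) _ (h2.trans_le h3)
    have h5 : C * N * (t * ‖z‖) ≤ C * N * (t * 1) := by
      gcongr
      exact (hbr z hz).trans hr1.le
    have h6 : ‖radialDeriv φ ((t : ℂ) • z)‖ * (1 / t) ≤ C * N := by
      rw [mul_one_div, div_le_iff₀ ht0]
      rw [h2] at h4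
      linarith
    simp only [hF, norm_mul, norm_div, norm_one, Complex.norm_real, Real.norm_of_nonneg ht.1.le]
    rw [mul_assoc]
    exact mul_le_mul (hB _ htz) h6 (by positivity) hB0
  obtain ⟨A, hA, -⟩ := hasFDerivAt_integral_of_norm_le (sub_pos.2 hr) (integrable_const _) hd hm hb
  have e : cesaro φ f = fun z => ∫ t, F t z ∂(volume.restrict (Ioc (0 : ℝ) 1)) := by
    funext z
    rw [cesaro, intervalIntegral.integral_of_le zero_le_one]
  rw [e]
  exact hA.differentiableAt.differentiableWithinAt

/-- The radial derivative of `T_φ f` is `f · Rφ`. -/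
theorem radialDeriv_cesaro {φ f : X → ℂ} (hφ : DifferentiableOn ℂ φ (ball 0 1))
    (hf : DifferentiableOn ℂ f (ball 0 1)) (hT : DifferentiableOn ℂ (cesaro φ f) (ball 0 1))
    {z : X} (hz : z ∈ ball (0 : X) 1) :
    radialDeriv (cesaro φ f) z = f z * radialDeriv φ z := by
  set k : ℝ → ℂ := fun t => f ((t : ℂ) • z) * fderiv ℂ φ ((t : ℂ) • z) z with hk
  have hkc := continuousOn_cesaro_slice hφ hf z
  have ho : IsOpen {t : ℝ | (t : ℂ) • z ∈ ball (0 : X) 1} :=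
    isOpen_ball.preimage (by fun_prop)
  have h1mem : (1 : ℝ) ∈ {t : ℝ | (t : ℂ) • z ∈ ball (0 : X) 1} := by simpa using hz
  have h1 : HasDerivAt (fun s : ℝ => cesaro φ f ((s : ℂ) • z))
      (fderiv ℂ (cesaro φ f) (((1 : ℝ) : ℂ) • z) z) 1 :=
    (hasDerivAt_slice hT z (ζ := ((1 : ℝ) : ℂ)) h1mem).comp_ofReal
  -- Rescaling the variable turns `T_φ f` along the ray into a primitive of `k`. Its derivative at
  -- `s = 1` is `k 1` by the fundamental theorem of calculus, and `D(T_φ f)(z)z` by the chain rule.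
  have h2 : (fun s : ℝ => cesaro φ f ((s : ℂ) • z)) = fun s : ℝ => ∫ t in (0 : ℝ)..s, k t := by
    funext s
    have := intervalIntegral.smul_integral_comp_mul_right (a := 0) (b := 1) k s
    rw [zero_mul, one_mul] at this
    rw [← this, cesaro_eq_integral_fderiv, ← intervalIntegral.integral_smul]
    refine intervalIntegral.integral_congr fun t _ => ?_
    simp only [hk, smul_smul, Complex.ofReal_mul, map_smul, Complex.real_smul, smul_eq_mul]
    ring
  have h3 : HasDerivAt (fun s : ℝ => ∫ t in (0 : ℝ)..s, k t) (k 1) 1 := by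
    refine intervalIntegral.integral_hasDerivAt_right ?_
      (hkc.stronglyMeasurableAtFilter ho _ h1mem) (hkc.continuousAt (ho.mem_nhds h1mem))
    refine ContinuousOn.intervalIntegrable (hkc.mono ?_)
    rw [uIcc_of_le zero_le_one]
    exact fun t ht => ofReal_smul_mem_unit_ball hz ht
  rw [h2] at h1
  have := h1.unique h3
  simpa [hk, radialDeriv] using this

end Cesaro

/-! ### Completeness of the little Bloch-type space. -/

section Completeness

variable {X : Type*} [NormedAddCommGroup X] [NormedSpace ℂ X]

/-- A locally normally convergent series of holomorphic functions may be differentiated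
term by term. -/
theorem hasFDerivAt_tsum_of_norm_le {F : ℕ → X → ℂ} {c : X} {R : ℝ} (hR : 0 < R) {b : ℕ → ℝ}
    (hb : Summable b) (hF : ∀ n, DifferentiableOn ℂ (F n) (ball c R))
    (hB : ∀ n, ∀ z ∈ ball c R, ‖F n z‖ ≤ b n) :
    ∃ A : X →L[ℂ] ℂ, HasFDerivAt (fun z => ∑' n, F n z) A c ∧
      ∀ v, A v = ∑' n, fderiv ℂ (F n) c v := by
  have hb0 : ∀ n, 0 ≤ b n := fun n => (norm_nonneg _).trans (hB n c (mem_ball_self hR))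
  -- The series is treated as a parameter integral against counting measure.
  have hint : ∀ g : ℕ → ℂ, Summable (fun n => ‖g n‖) →
      ∫ n, g n ∂Measure.count = ∑' n, g n := fun g hg => by
    rw [integral_countable (integrable_count_iff.2 hg)]
    simp
  have hbi : Integrable b Measure.count := integrable_count_iff.2 hb.norm
  obtain ⟨A, hA, hA'⟩ := hasFDerivAt_integral_of_norm_le hR hbi (Eventually.of_forall hF)
    (fun z _ => (measurable_of_countable _).aestronglyMeasurable) (Eventually.of_forall hB)
  refine ⟨A, hA.congr_of_eventuallyEq ?_, fun v => ?_⟩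
  · filter_upwards [ball_mem_nhds c hR] with z hz
    exact (hint _ (hb.of_nonneg_of_le (fun n => norm_nonneg _) fun n => hB n z hz)).symm
  · rw [hA', hint]
    refine (((hb.mul_left 2).div_const R).mul_right ‖v‖).of_nonneg_of_le
      (fun n => norm_nonneg _) fun n => ?_
    exact (fderiv ℂ (F n) c).le_of_opNorm_le (norm_fderiv_le_of_norm_le hR (hF n) (hB n)) v

variable {ω : NormalFunction}

lemma radialDeriv_sum_range (u : ℕ → littleBlochSpace X ω) (n : ℕ) {z : X}
    (hz : z ∈ ball (0 : X) 1) :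
    radialDeriv ((∑ i ∈ Finset.range n, u i : littleBlochSpace X ω) : BlochSpace X ω) z =
      ∑ i ∈ Finset.range n, radialDeriv (u i : BlochSpace X ω) z := by
  induction n with
  | zero =>
    change fderiv ℂ (0 : X → ℂ) z z = 0
    simp
  | succ n ih =>
    rw [Finset.sum_range_succ, Finset.sum_range_succ, ← ih]
    exact radialDeriv_add (∑ i ∈ Finset.range n, u i : littleBlochSpace X ω).2.1 (u n).2.1 hz

lemma apply_sum_range (u : ℕ → littleBlochSpace X ω) (n : ℕ) (z : X) :
    ((∑ i ∈ Finset.range n, u i : littleBlochSpace X ω) : BlochSpace X ω) z =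
      ∑ i ∈ Finset.range n, (u i : BlochSpace X ω) z := by
  induction n with
  | zero => rfl
  | succ n ih =>
    rw [Finset.sum_range_succ, Finset.sum_range_succ, ← ih]
    rfl

lemma norm_tsum_sub_sum_range_le {g : ℕ → ℂ} {b : ℕ → ℝ} (hb : Summable b)
    (h : ∀ n, ‖g n‖ ≤ b n) (n : ℕ) :
    ‖∑ i ∈ Finset.range n, g i - ∑' i, g i‖ ≤ ∑' i, b (i + n) := by
  have hg : Summable g := Summable.of_norm_bounded hb h
  rw [← hg.sum_add_tsum_nat_add n, sub_add_cancel_left, norm_neg]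
  exact tsum_of_norm_bounded ((summable_nat_add_iff n).2 hb).hasSum fun i => h (i + n)

lemma MemLittleBloch.of_uniform_approx {f : X → ℂ} (hf : DifferentiableOn ℂ f (ball 0 1))
    (h : ∀ ε > 0, ∃ g : X → ℂ, MemLittleBloch ω g ∧
      ∀ z ∈ ball (0 : X) 1, ω ‖z‖ * ‖radialDeriv g z - radialDeriv f z‖ ≤ ε) :
    MemLittleBloch ω f := by
  refine ⟨hf, ?_⟩
  rw [Metric.tendsto_nhds]
  intro ε hε
  obtain ⟨g, hg, hgf⟩ := h (ε / 2) (by positivity)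
  filter_upwards [eventually_mem_ball, Metric.tendsto_nhds.1 hg.2 (ε / 2) (by positivity)]
    with z hz h1
  have hp := normalFunction_pos ω hz
  rw [dist_zero_right, Real.norm_of_nonneg (by positivity)] at h1 ⊢
  have h2 := hgf z hz
  have h3 : ‖radialDeriv f z‖ ≤ ‖radialDeriv g z‖ + ‖radialDeriv g z - radialDeriv f z‖ := by
    exact norm_le_insert _ _
  have h4 := mul_le_mul_of_nonneg_left h3 hp.le
  linarith

/-- Absolutely summable series converge: the pointwise sum converges normally on smaller balls, so
`R` passes through it. The tail estimate `hR` then yields both the boundary decay of the limit and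
convergence in norm. -/
instance : CompleteSpace (littleBlochSpace X ω) := by
  refine NormedAddCommGroup.completeSpace_of_summable_imp_tendsto fun u hu => ?_
  set f : X → ℂ := fun z => ∑' n, (u n : BlochSpace X ω) z with hf
  have hder : ∀ z ∈ ball (0 : X) 1, DifferentiableAt ℂ f z ∧
      radialDeriv f z = ∑' n, radialDeriv (u n : BlochSpace X ω) z := by
    intro z hz
    obtain ⟨r, hr, hr1⟩ := exists_between (mem_ball_zero_iff.1 hz)
    obtain ⟨C, hC0, hC⟩ := exists_norm_apply_le_on_smaller_ball X ω hr1
    have hbr : ∀ w ∈ ball z (r - ‖z‖), ‖w‖ ≤ r := fun w hw => by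
      rw [mem_ball, dist_eq_norm] at hw
      linarith [norm_le_insert' w z]
    obtain ⟨A, hA, hA'⟩ := hasFDerivAt_tsum_of_norm_le (F := fun n => (u n : BlochSpace X ω))
      (sub_pos.2 hr) (hu.mul_left C)
      (fun n => (u n).2.1.mono fun w hw => mem_ball_zero_iff.2 ((hbr w hw).trans_lt hr1))
      (fun n w hw => hC _ w (hbr w hw))
    refine ⟨hA.differentiableAt, ?_⟩
    rw [radialDeriv, hA.fderiv, hA']
    rfl
  have hfd : DifferentiableOn ℂ f (ball 0 1) := fun z hz => (hder z hz).1.differentiableWithinAt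
  have hR : ∀ n, ∀ z ∈ ball (0 : X) 1, ω ‖z‖ * ‖radialDeriv
      ((∑ i ∈ Finset.range n, u i : littleBlochSpace X ω) : BlochSpace X ω) z - radialDeriv f z‖ ≤
      ∑' i, ‖u (i + n)‖ := by
    intro n z hz
    have hp := normalFunction_pos ω hz
    rw [radialDeriv_sum_range u n hz, (hder z hz).2]
    have := norm_tsum_sub_sum_range_le (g := fun i => radialDeriv (u i : BlochSpace X ω) z)
      (hu.mul_left (1 / ω ‖z‖)) (fun i => by
        rw [one_div_mul_eq_div, le_div_iff₀ hp, mul_comm]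
        exact mul_norm_radialDeriv_le_norm (u i : BlochSpace X ω) hz) n
    rw [tsum_mul_left, one_div_mul_eq_div, le_div_iff₀ hp] at this
    rwa [mul_comm]
  have htail : Tendsto (fun n => ∑' i, ‖u (i + n)‖) atTop (𝓝 0) :=
    tendsto_sum_nat_add fun i => ‖u i‖
  have hlit : MemLittleBloch ω f := by
    refine MemLittleBloch.of_uniform_approx hfd fun ε hε => ?_
    obtain ⟨n, hn⟩ := (htail.eventually (gt_mem_nhds hε)).exists
    exact ⟨_, (∑ i ∈ Finset.range n, u i : littleBlochSpace X ω).2,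
      fun z hz => (hR n z hz).trans hn.le⟩
  have hout : ∀ z ∉ ball (0 : X) 1, f z = 0 := fun z hz => by
    have : ∀ n, (u n : BlochSpace X ω) z = 0 := fun n => (u n : BlochSpace X ω).2.2 z hz
    simp [hf, this]
  let a : littleBlochSpace X ω := ⟨⟨f, hlit.memBloch, hout⟩, hlit⟩
  refine ⟨a, tendsto_iff_norm_sub_tendsto_zero.2 ?_⟩
  refine squeeze_zero (fun n => norm_nonneg _) (fun n => ?_) (by simpa using htail.add htail)
  set s : littleBlochSpace X ω := ∑ i ∈ Finset.range n, u i with hs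
  refine blochSpace_norm_le (f := ((s - a : littleBlochSpace X ω) : BlochSpace X ω)) ?_ ?_
  · have : ((s - a : littleBlochSpace X ω) : BlochSpace X ω) 0 = (s : BlochSpace X ω) 0 - f 0 := rfl
    rw [this, hs, apply_sum_range]
    exact norm_tsum_sub_sum_range_le hu (fun i => norm_zero_le_norm (u i : BlochSpace X ω)) n
  · intro z hz
    have : radialDeriv ((s - a : littleBlochSpace X ω) : BlochSpace X ω) z =
        radialDeriv (s : BlochSpace X ω) z - radialDeriv f z := by
      change fderiv ℂ ((s : BlochSpace X ω).1 - f) z z = _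
      rw [fderiv_sub (differentiableAt_of_ball s.2.1 hz) (differentiableAt_of_ball hfd hz)]
      rfl
    rw [this]
    exact hR n z hz

end Completeness

/-! ### Compactness of the operator, and the two implications. -/

section Compactness

variable {X : Type*} [NormedAddCommGroup X] [NormedSpace ℂ X] {ω μ : NormalFunction}

/-- Uniformly bounded holomorphic functions are uniformly close to each other on a compact set
as soon as they are close at finitely many points. -/
lemma exists_finite_forall_norm_sub_le {K : Set X} (hK : IsCompact K) (hK1 : K ⊆ ball 0 1)
    (B : ℝ) {η : ℝ} (hη : 0 < η) :
    ∃ t : Finset X, ∀ f g : X → ℂ, DifferentiableOn ℂ f (ball 0 1) →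
      DifferentiableOn ℂ g (ball 0 1) → (∀ z ∈ ball (0 : X) 1, ‖f z‖ ≤ B) →
      (∀ z ∈ ball (0 : X) 1, ‖g z‖ ≤ B) → (∀ x ∈ t, ‖f x - g x‖ ≤ η) →
      ∀ z ∈ K, ‖f z - g z‖ ≤ 3 * η := by
  -- Equicontinuity: Schwarz's lemma gives a Lipschitz-type bound at `x` depending only on `B` and
  -- the distance from `x` to the unit sphere, so `δ` serves all `f`.
  have hloc : ∀ x ∈ K, ∃ δ > 0, ∀ f : X → ℂ, DifferentiableOn ℂ f (ball 0 1) →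
      (∀ z ∈ ball (0 : X) 1, ‖f z‖ ≤ B) → ∀ z ∈ ball x δ, ‖f z - f x‖ ≤ η := by
    intro x hx
    have hx1 : 0 < 1 - ‖x‖ := sub_pos.2 (mem_ball_zero_iff.1 (hK1 hx))
    have hsub : ball x (1 - ‖x‖) ⊆ ball 0 1 := fun z hz => by
      rw [mem_ball, dist_eq_norm] at hz
      rw [mem_ball_zero_iff]
      linarith [norm_le_insert' z x]
    refine ⟨min (1 - ‖x‖) (η * (1 - ‖x‖) / (2 * |B| + 1)), lt_min hx1 (by positivity),
      fun f hf hB z hz => ?_⟩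
    have hz1 : z ∈ ball x (1 - ‖x‖) := ball_subset_ball (min_le_left _ _) hz
    have hz2 : dist z x ≤ η * (1 - ‖x‖) / (2 * |B| + 1) :=
      (mem_ball.1 (ball_subset_ball (min_le_right _ _) hz)).le
    have h1 := Complex.dist_le_div_mul_dist_of_mapsTo_ball (hf.mono hsub)
      (mapsTo_closedBall_of_norm_le hx1 fun w hw => hB w (hsub hw)) hz1
    rw [dist_eq_norm] at h1
    have h2 : 2 * B / (1 - ‖x‖) ≤ (2 * |B| + 1) / (1 - ‖x‖) := by
      gcongr
      linarith [le_abs_self B]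
    calc ‖f z - f x‖ ≤ 2 * B / (1 - ‖x‖) * dist z x := h1
      _ ≤ (2 * |B| + 1) / (1 - ‖x‖) * (η * (1 - ‖x‖) / (2 * |B| + 1)) := by gcongr
      _ = η := by field_simp
  choose! δ hδ hδ' using hloc
  obtain ⟨t, htK, ht⟩ := hK.elim_nhds_subcover (fun x => ball x (δ x))
    fun x hx => ball_mem_nhds x (hδ x hx)
  refine ⟨t, fun f g hf hg hfB hgB hfg z hz => ?_⟩
  obtain ⟨x, hx, hzx⟩ := mem_iUnion₂.1 (ht hz)
  have h1 := hδ' x (htK x hx) f hf hfB z hzx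
  have h2 := hδ' x (htK x hx) g hg hgB z hzx
  have h3 := hfg x hx
  have e : f z - g z = (f z - f x) + (f x - g x) - (g z - g x) := by ring
  rw [e]
  linarith [norm_sub_le (f z - f x + (f x - g x)) (g z - g x),
    norm_add_le (f z - f x) (f x - g x)]

lemma MemLittleBloch.exists_forall_lt {φ : X → ℂ} (hφ : MemLittleBloch μ φ) {ε : ℝ} (hε : 0 < ε) :
    ∃ ρ ∈ Ioo (0 : ℝ) 1, ∀ z : X, ρ < ‖z‖ → ‖z‖ < 1 → μ ‖z‖ * ‖radialDeriv φ z‖ < ε := by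
  obtain ⟨s, hs, hs'⟩ := mem_comap.1 (hφ.2.eventually (gt_mem_nhds hε))
  obtain ⟨l, hl, hls⟩ := (mem_nhdsLT_iff_exists_Ioo_subset' (zero_lt_one' ℝ)).1 hs
  obtain ⟨ρ, hρ0, hρ1⟩ := exists_between (max_lt hl (zero_lt_one' ℝ))
  exact ⟨ρ, ⟨(le_max_right _ _).trans_lt hρ0, hρ1⟩, fun z h h' =>
    hs' (hls ⟨((le_max_left _ _).trans_lt hρ0).trans h, h'⟩)⟩

lemma radialDeriv_indicator {f : X → ℂ} {z : X} (hz : z ∈ ball (0 : X) 1) :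
    radialDeriv ((ball (0 : X) 1).indicator f) z = radialDeriv f z :=
  radialDeriv_congr (eqOn_indicator) hz

lemma MemLittleBloch.congr {f g : X → ℂ} (hf : MemLittleBloch μ f)
    (hg : DifferentiableOn ℂ g (ball 0 1))
    (h : ∀ z ∈ ball (0 : X) 1, radialDeriv g z = radialDeriv f z) : MemLittleBloch μ g := by
  refine ⟨hg, hf.2.congr' ?_⟩
  filter_upwards [eventually_mem_ball] with z hz
  rw [h z hz]

lemma memLittleBloch_cesaro {φ f : X → ℂ} (hφ : MemLittleBloch μ φ)
    (hf : DifferentiableOn ℂ f (ball 0 1)) {B : ℝ} (hB : ∀ z ∈ ball (0 : X) 1, ‖f z‖ ≤ B) :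
    MemLittleBloch μ (cesaro φ f) := by
  have hT := differentiableOn_cesaro hφ.memBloch hf hB
  refine ⟨hT, squeeze_zero' ?_ ?_ (by simpa using hφ.2.const_mul B)⟩
  · filter_upwards [eventually_mem_ball] with z hz
    exact mul_nonneg (normalFunction_pos μ hz).le (norm_nonneg _)
  · filter_upwards [eventually_mem_ball] with z hz
    have hp := normalFunction_pos μ hz
    rw [radialDeriv_cesaro hφ.1 hf hT hz, norm_mul, mul_left_comm]
    exact mul_le_mul_of_nonneg_right (hB z hz) (by positivity)

/-- An operator with `S f (0) = 0` and `R(S f) = f · Rφ` is compact, if `φ` is a little Bloch-type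
function whose sets `E_{ε,ρ}` are relatively compact and the little Bloch-type functions in its
domain are bounded. -/
theorem isCompactOperator_of_radialDeriv_eq {φ : X → ℂ} (hφ : MemLittleBloch μ φ)
    (hE : ∀ ε : ℝ, 0 < ε → ∀ ρ ∈ Ioo (0 : ℝ) 1, RelativelyCompactInBall (symbolSet μ φ ε ρ))
    {C : ℝ} (hC0 : 0 ≤ C)
    (hC : ∀ f : BlochSpace X ω, ∀ z ∈ ball (0 : X) 1, ‖f z‖ ≤ C * ‖f‖)
    (S : littleBlochSpace X ω →L[ℂ] littleBlochSpace X μ)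
    (hS0 : ∀ f, (S f : BlochSpace X μ) 0 = 0)
    (hSR : ∀ f, ∀ z ∈ ball (0 : X) 1, radialDeriv (S f : BlochSpace X μ) z =
      (f : BlochSpace X ω) z * radialDeriv φ z) : IsCompactOperator S := by
  rw [isCompactOperator_iff_exists_mem_nhds_isCompact_closure_image]
  set V : Set (littleBlochSpace X ω) := ball 0 1 with hV
  refine ⟨V, ball_mem_nhds 0 one_pos, ?_⟩
  refine TotallyBounded.isCompact_of_isClosed (TotallyBounded.closure ?_) isClosed_closure
  have hVC : ∀ f ∈ V, ∀ z ∈ ball (0 : X) 1, ‖(f : BlochSpace X ω) z‖ ≤ C := fun f hf z hz => by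
    have h1 : ‖(f : BlochSpace X ω)‖ ≤ 1 := (mem_ball_zero_iff.1 hf).le
    exact (hC f z hz).trans (mul_le_of_le_one_right hC0 h1)
  obtain ⟨M, hM⟩ := hφ.memBloch.2
  have hM' : ∀ z ∈ ball (0 : X) 1, μ ‖z‖ * ‖radialDeriv φ z‖ ≤ M := fun z hz => hM ⟨⟨z, hz⟩, rfl⟩
  have hM0 : 0 ≤ M := by simpa [radialDeriv_zero] using hM' 0 (by simp)
  rw [Metric.totallyBounded_iff]
  intro ε hε
  -- `ε'` is the threshold for `μ |Rφ|`, multiplied later by `2 * C`; `η` is the tolerance at the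
  -- sample points, multiplied by `3 * M`. Each product is at most `ε / 2`, and the added ones avoid
  -- division by zero.
  set ε' := ε / (4 * (C + 1)) with hε'
  have hε'0 : 0 < ε' := by positivity
  have hε'C : 2 * C * ε' ≤ ε / 2 := by
    rw [hε', mul_div_assoc', div_le_div_iff₀ (by positivity) (by positivity)]
    nlinarith
  set η := ε / (6 * (M + 1)) with hη
  have hη0 : 0 < η := by positivity
  have hηM : 3 * η * M ≤ ε / 2 := by
    rw [hη, mul_div_assoc', div_mul_eq_mul_div, div_le_div_iff₀ (by positivity) (by positivity)]
    nlinarith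
  obtain ⟨ρ, hρ, hρφ⟩ := hφ.exists_forall_lt hε'0
  obtain ⟨K, hK, hK1, hEK⟩ := hE ε' hε'0 ρ hρ
  obtain ⟨t, ht⟩ := exists_finite_forall_norm_sub_le hK hK1 C hη0
  have hclose : ∀ f ∈ V, ∀ g ∈ V,
      (∀ x ∈ t, ‖(f : BlochSpace X ω) x - (g : BlochSpace X ω) x‖ ≤ η) →
      dist (S f) (S g) < ε := by
    intro f hf g hg hfg
    have hdiff := ht (f : BlochSpace X ω) (g : BlochSpace X ω) f.2.1 g.2.1 (hVC f hf) (hVC g hg) hfg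
    rw [dist_eq_norm, ← map_sub]
    have hle : ‖S (f - g)‖ ≤ 0 + ε / 2 := by
      refine blochSpace_norm_le (f := (S (f - g) : BlochSpace X μ)) (by rw [hS0, norm_zero]) fun z hz => ?_
      have hp := normalFunction_pos μ hz
      have e : ((f - g : littleBlochSpace X ω) : BlochSpace X ω) z =
        (f : BlochSpace X ω) z - (g : BlochSpace X ω) z := rfl
      rw [hSR _ z hz, norm_mul, e, mul_left_comm]
      by_cases hz' : ‖z‖ ≤ ρ ∧ ε' ≤ μ ‖z‖ * ‖radialDeriv φ z‖
      -- The point lies in `E_{ε',ρ}` with the choice `s = 1`.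
      · have hzK : z ∈ K := hEK ⟨mem_ball_zero_iff.1 hz, hz'.1, 1,
          ⟨le_rfl, (one_le_inv₀ hρ.1).2 hρ.2.le⟩, by simpa using hz, by simpa using hz'.2⟩
        exact (mul_le_mul (hdiff z hzK) (hM' z hz) (by positivity) (by positivity)).trans hηM
      · have h1 : μ ‖z‖ * ‖radialDeriv φ z‖ ≤ ε' := by
          by_contra! h
          refine hz' ⟨?_, h.le⟩
          by_contra! h2
          exact h.not_gt (hρφ z h2 (mem_ball_zero_iff.1 hz))
        have h2 : ‖(f : BlochSpace X ω) z - (g : BlochSpace X ω) z‖ ≤ 2 * C := by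
          linarith [norm_sub_le ((f : BlochSpace X ω) z) ((g : BlochSpace X ω) z),
            hVC f hf z hz, hVC g hg z hz]
        exact (mul_le_mul h2 h1 (by positivity) (by positivity)).trans hε'C
    linarith
  -- Evaluation at the sample points sends `V` to a bounded set in a finite-dimensional space. By
  -- `hclose`, a finite `η`-net of `Φ '' V` lifts to a finite `ε`-net of `S '' V`.
  set Φ : littleBlochSpace X ω → (t → ℂ) := fun f x => (f : BlochSpace X ω) x with hΦ
  have hP : TotallyBounded (Φ '' V) := by
    refine TotallyBounded.subset ?_ (isCompact_closedBall (0 : t → ℂ) C).totallyBounded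
    rintro _ ⟨f, hf, rfl⟩
    rw [mem_closedBall_zero_iff, pi_norm_le_iff_of_nonneg hC0]
    intro x
    -- Nothing recorded about `t` places it inside the ball; outside, the extension by `0` gives the
    -- bound.
    by_cases hx : (x : X) ∈ ball (0 : X) 1
    · exact hVC f hf x hx
    · have : (f : BlochSpace X ω) x = 0 := (f : BlochSpace X ω).2.2 x hx
      simpa [hΦ, this] using hC0
  obtain ⟨T, hTP, hTfin, hT⟩ := Metric.finite_approx_of_totallyBounded hP η hη0
  have hpre : ∀ p ∈ T, ∃ f : littleBlochSpace X ω, f ∈ V ∧ Φ f = p := fun p hp => hTP hp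
  choose! g hgV hg using hpre
  refine ⟨(fun p => S (g p)) '' T, hTfin.image _, ?_⟩
  rintro _ ⟨f, hf, rfl⟩
  obtain ⟨p, hp, hfp⟩ := mem_iUnion₂.1 (hT ⟨f, hf, rfl⟩)
  refine mem_iUnion₂.2 ⟨S (g p), ⟨p, hp, rfl⟩, ?_⟩
  refine hclose f hf (g p) (hgV p hp) fun x hx => ?_
  rw [← hg p hp, mem_ball, dist_eq_norm] at hfp
  exact (norm_le_pi_norm (Φ f - Φ (g p)) ⟨x, hx⟩).trans hfp.le

theorem MemLittleBloch.cesaroCompactLittle {φ : X → ℂ} (hφ : MemLittleBloch μ φ)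
    (hE : ∀ ε : ℝ, 0 < ε → ∀ ρ ∈ Ioo (0 : ℝ) 1, RelativelyCompactInBall (symbolSet μ φ ε ρ))
    (hω : IntegrableOn (fun t : ℝ => 1 / ω t) (Ioo (0 : ℝ) 1)) : CesaroCompactLittle ω μ φ := by
  obtain ⟨C, hC0, hC⟩ := exists_norm_apply_le X hω
  obtain ⟨M, hM⟩ := hφ.memBloch.2
  have hM' : ∀ z ∈ ball (0 : X) 1, μ ‖z‖ * ‖radialDeriv φ z‖ ≤ M := fun z hz => hM ⟨⟨z, hz⟩, rfl⟩
  have hlit : ∀ f : BlochSpace X ω, MemLittleBloch μ (cesaro φ f) := fun f =>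
    memLittleBloch_cesaro hφ f.2.1.1 (hC f)
  -- Elements of the target vanish off the ball, so `cesaro φ f` is cut off there; its radial
  -- derivative on the ball is unchanged.
  have hlit' : ∀ f : BlochSpace X ω, MemLittleBloch μ ((ball (0 : X) 1).indicator (cesaro φ f)) :=
    fun f => (hlit f).congr ((hlit f).1.congr fun z hz => indicator_of_mem hz _)
      fun z hz => radialDeriv_indicator hz
  let S₀ : littleBlochSpace X ω →ₗ[ℂ] littleBlochSpace X μ :=
    { toFun := fun f => ⟨⟨(ball (0 : X) 1).indicator (cesaro φ (f : BlochSpace X ω)),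
        (hlit' f).memBloch, fun z hz => indicator_of_notMem hz _⟩, hlit' f⟩
      map_add' := fun f g => by
        refine Subtype.ext (Subtype.ext (funext fun z => ?_))
        change (ball (0 : X) 1).indicator
            (cesaro φ ((f : BlochSpace X ω).1 + (g : BlochSpace X ω).1)) z =
          (ball (0 : X) 1).indicator (cesaro φ (f : BlochSpace X ω)) z +
          (ball (0 : X) 1).indicator (cesaro φ (g : BlochSpace X ω)) z
        by_cases hz : z ∈ ball (0 : X) 1
        · simp only [indicator_of_mem hz]
          exact cesaro_add hφ.1 f.2.1 g.2.1 hz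
        · simp only [indicator_of_notMem hz, add_zero]
      map_smul' := fun c f => by
        refine Subtype.ext (Subtype.ext (funext fun z => ?_))
        change (ball (0 : X) 1).indicator (cesaro φ (c • (f : BlochSpace X ω).1)) z =
          c * (ball (0 : X) 1).indicator (cesaro φ (f : BlochSpace X ω)) z
        by_cases hz : z ∈ ball (0 : X) 1
        · simp only [indicator_of_mem hz]
          exact cesaro_smul _ _ _ _
        · simp only [indicator_of_notMem hz, mul_zero] }
  have hS : ∀ f, ∀ z ∈ ball (0 : X) 1,
      (S₀ f : BlochSpace X μ) z = cesaro φ (f : BlochSpace X ω) z := fun f z hz =>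
    indicator_of_mem hz _
  have hS0 : ∀ f, (S₀ f : BlochSpace X μ) 0 = 0 := fun f => by
    rw [hS f 0 (by simp), cesaro_zero]
  have hSR : ∀ f, ∀ z ∈ ball (0 : X) 1, radialDeriv (S₀ f : BlochSpace X μ) z =
      (f : BlochSpace X ω) z * radialDeriv φ z := fun f z hz => by
    rw [radialDeriv_congr (hS f) hz, radialDeriv_cesaro hφ.1 f.2.1 (hlit f).1 hz]
  let S : littleBlochSpace X ω →L[ℂ] littleBlochSpace X μ := S₀.mkContinuous (C * M) fun f => by
    have : ‖S₀ f‖ ≤ 0 + C * M * ‖f‖ := by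
      refine blochSpace_norm_le (f := (S₀ f : BlochSpace X μ)) (by simp [hS0]) fun z hz => ?_
      have hp := normalFunction_pos μ hz
      rw [hSR f z hz, norm_mul, mul_left_comm, mul_right_comm]
      exact mul_le_mul (hC f z hz) (hM' z hz) (by positivity) (mul_nonneg hC0 (norm_nonneg _))
    simpa using this
  exact ⟨S, hS, isCompactOperator_of_radialDeriv_eq hφ hE hC0 hC S hS0 hSR⟩

/-- `T_φ 1 = φ - φ(0)`, so `φ` is of little Bloch type if `T_φ 1` is. -/
theorem CesaroCompactLittle.memLittleBloch {φ : X → ℂ} (hφ : DifferentiableOn ℂ φ (ball 0 1))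
    (h : CesaroCompactLittle ω μ φ) : MemLittleBloch μ φ := by
  obtain ⟨S, hS, -⟩ := h
  have hone : EqOn ((ball (0 : X) 1).indicator fun _ => (1 : ℂ)) (fun _ => 1) (ball 0 1) :=
    eqOn_indicator
  have hlit : MemLittleBloch ω ((ball (0 : X) 1).indicator fun _ => (1 : ℂ)) := by
    have h0 : MemLittleBloch ω (0 : X → ℂ) := (0 : littleBlochSpace X ω).2
    refine h0.congr ((differentiableOn_const 1).congr hone) fun z hz => ?_
    rw [radialDeriv_congr hone hz]
    simp [radialDeriv]
  let o : littleBlochSpace X ω :=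
    ⟨⟨_, hlit.memBloch, fun z hz => indicator_of_notMem hz _⟩, hlit⟩
  refine MemLittleBloch.congr (S o).2 hφ fun z hz => ?_
  have e : EqOn (S o : BlochSpace X μ) (fun z => φ z - φ 0) (ball 0 1) := fun w hw => by
    rw [hS o w hw]
    exact cesaro_one hφ hw hone
  rw [radialDeriv_congr e hz]
  simp [radialDeriv, fderiv_sub_const]

end Compactness

theorem corollary4p5 {X : Type*} [NormedAddCommGroup X] [NormedSpace ℂ X] [CompleteSpace X]
    (ω μ : NormalFunction) (φ : X → ℂ) (hφ : DifferentiableOn ℂ φ (ball (0 : X) 1))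
    (hE : ∀ ε : ℝ, 0 < ε → ∀ ρ ∈ Ioo (0 : ℝ) 1, RelativelyCompactInBall (symbolSet μ φ ε ρ))
    (hω : IntegrableOn (fun t : ℝ => 1 / ω t) (Ioo (0 : ℝ) 1)) :
    CesaroCompactLittle ω μ φ ↔ MemLittleBloch μ φ :=
  ⟨fun h => h.memLittleBloch hφ, fun h => h.cesaroCompactLittle hE hω⟩
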